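/- Let $G=(V,E)$ be a finite connected simple graph with $n\ge 2$ vertices and $m$ edges, and let $P$ be the transition matrix of the lazy random walk on $G$ (stay put with probability $1/2$, otherwise move to a uniformly chosen neighbour), with stationary distribution $\pi(u)=\deg(u)/2m$ and eigenvalues $1=\lambda_1>\lambda_2\ge\dots\ge\lambda_n\ge 0$. Let $$t_{\mathrm{rel}}=\Big\lceil \frac1{1-\lambda_2}\Big\rceil,\qquad t_{\mathrm{unif}}=\inf\Big\{t\ge 0:\ \max_{x,y\in V}\Big|\frac{P^t(x,y)}{\pi(y)}-1\Big|\le \frac14\Big\}.$$ For two independent lazy random walks $X,Y$ on $G$, both started at $x\in V$, let $$\mathcal J_t=\sum_{i,j=t_{\mathrm{unif}}}^{t_{\mathrm{unif}}+t-1}\frac{1}{\deg(X_i)}\,\mathbf 1_{\{X_i=Y_j\}}.$$ (1) For all such $G$, all $x\in V$ and all integers $t\ge 0$, $$\Big(\frac34\Big)^2\frac{t^2}{2m}\le \mathbb E_x\mathcal J_t\le\Big(\frac54\Big)^2\frac{t^2}{2m}.$$ (2) There is an absolute constant $C>0$ such that for all such $G$, $x$ and $t$, $$\mathbb E_x\mathcal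 J_t^2\le C\,\frac{t^2}{m^2}\Big(t^2+n\,t_{\mathrm{rel}}^{5/3}\Big).$$ (3) For integers $K,t\ge 1$ consider $2K$ independent lazy random walks on $G$, all started at $x$, grouped into $K$ pairs; let $\mathcal J_t^{(1)},\dots,\mathcal J_t^{(K)}$ be the resulting independent copies of $\mathcal J_t$, and let $$\widetilde m_t=\frac{t^2}{\frac2K\sum_{k=1}^K\mathcal J_t^{(k)}}.$$ Given $t_{\mathrm{unif}}$, $t$ and $K$, the value $\widetilde m_t$ is a function of the profile of the concatenated trajectories of the $2K$ walks, each observed at times $0,\dots,t_{\mathrm{unif}}+t-1$; here the profile of a finite sequence of vertices records the degree of each term and its rank in the order of first occurrence. For every $c>0$ there is $C>0$, depending only on $c$, such that for all $G$, $x$ and $K\ge1$, and all $t\ge c\,t_{\mathrm{rel}}^{5/6}\sqrt n$, $$\mathbb P_x\Big(\Big|\frac{\widetilde m_t}{m}-1\Big|>\frac12\Big)\le\frac CK .$$ Moreover there is an absolute constant $C>0$ such that for every $\varepsilon\in(0,1]$ there is an integer $K_0=K_0(\varepsilon)\ge1$ such that for every $G$ there is an integer $t_0\ge1$ for which the error probability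 $\mathbb P_x(|\widetilde m_t/m-1|>\frac12)$ is at most $\varepsilon$ for all $x\in V$, $t\ge t_0$ and $K\ge K_0$, while the total number of random walk steps satisfies $$2K_0\,(t_{\mathrm{unif}}+t_0)\le C\,\varepsilon^{-1}\Big(t_{\mathrm{unif}}+t_{\mathrm{rel}}^{5/6}\sqrt n\Big).$$ -/

import Mathlib

open MeasureTheory ProbabilityTheory

universe u v

noncomputable section

namespace LazyWalk

variable {V : Type*} [Fintype V] [DecidableEq V]

/-- The number `m` of edges. -/
def numEdges (G : SimpleGraph V) [DecidableRel G.Adj] : ℕ := G.edgeFinset.card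

/-- Transition matrix of the lazy random walk: stay put with probability `1/2`, otherwise move to
a uniformly chosen neighbour. -/
def transition (G : SimpleGraph V) [DecidableRel G.Adj] : Matrix V V ℝ :=
  Matrix.of fun u v =>
    (if u = v then 1 / 2 else 0) + (if G.Adj u v then 1 / (2 * (G.degree u : ℝ)) else 0)

/-- The stationary distribution `π(u) = deg(u) / 2m`. -/
def stationary (G : SimpleGraph V) [DecidableRel G.Adj] (u : V) : ℝ :=
  (G.degree u : ℝ) / (2 * (numEdges G : ℝ))

/-- The uniform mixing time, with threshold `1/4`. -/
def tUnif (G : SimpleGraph V) [DecidableRel G.Adj] : ℕ :=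
  sInf {t : ℕ | ∀ x y : V, |(transition G ^ t) x y / stationary G y - 1| ≤ 1 / 4}

/-- The eigenvalues `λ₁ ≥ λ₂ ≥ …` of the transition matrix, with multiplicity, in decreasing
order. -/
def eigenvalueList (G : SimpleGraph V) [DecidableRel G.Adj] : List ℝ :=
  (transition G).charpoly.roots.sort (· ≥ ·)

/-- The second largest eigenvalue `λ₂` (the default is irrelevant on at least two vertices). -/
def lambdaTwo (G : SimpleGraph V) [DecidableRel G.Adj] : ℝ := (eigenvalueList G).getD 1 0

/-- The relaxation time `⌈1 / (1 - λ₂)⌉`. -/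
def tRel (G : SimpleGraph V) [DecidableRel G.Adj] : ℕ := ⌈1 / (1 - lambdaTwo G)⌉₊

/-- `X` is, under `μ`, a lazy random walk on `G` started at `x`. -/
structure IsLazyWalk (G : SimpleGraph V) [DecidableRel G.Adj] [MeasurableSpace V] (x : V)
    {Ω : Type*} [MeasurableSpace Ω] (μ : Measure Ω) (X : ℕ → Ω → V) : Prop where
  measurable : ∀ i, Measurable (X i)
  law : ∀ (k : ℕ) (u : ℕ → V), μ.real {ω | ∀ i ≤ k, X i ω = u i} =
    if u 0 = x then ∏ i ∈ Finset.range k, transition G (u i) (u (i + 1)) else 0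

/-- The weighted number of intersections of the paths `a`, `b` over the time window
`[s, s + t)`. -/
def weightedIntersections (G : SimpleGraph V) [DecidableRel G.Adj] (s t : ℕ) (a b : ℕ → V) : ℝ :=
  ∑ i ∈ Finset.Ico s (s + t), ∑ j ∈ Finset.Ico s (s + t),
    if a i = b j then 1 / (G.degree (a i) : ℝ) else 0

/-- `𝓙_t`: the weighted number of intersections, counted from the uniform mixing time on. -/
def interJ (G : SimpleGraph V) [DecidableRel G.Adj] (t : ℕ) (a b : ℕ → V) : ℝ :=
  weightedIntersections G (tUnif G) t a b

/-- The edge estimator `t² / ((2/K) ∑ₖ 𝓙⁽ᵏ⁾)` computed from `K` pairs of paths, with the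
intersections of each pair counted over the window `[s, s + t)`. The `k`-th pair consists of the
paths number `2k` and `2k + 1`. -/
def edgeEstimator (G : SimpleGraph V) [DecidableRel G.Adj] (s t K : ℕ)
    (w : Fin (K * 2) → ℕ → V) : ℝ :=
  (t : ℝ) ^ 2 / (2 / (K : ℝ) * ∑ k : Fin K,
    weightedIntersections G s t (w (finProdFinEquiv (k, 0))) (w (finProdFinEquiv (k, 1))))

/-- Each vertex of a finite sequence is replaced by its rank in the order of first occurrence:
`rank u i` is the number of distinct vertices seen up to the first occurrence of `u i`. -/
def rank {N : ℕ} (u : Fin N → V) (i : Fin N) : ℕ :=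
  Set.ncard {v : V | ∃ j, u j = v ∧ ∀ l, u l = u i → j ≤ l}

/-- The profile of a finite sequence of vertices: ranks of occurrence, and degrees. -/
def profile (G : SimpleGraph V) [DecidableRel G.Adj] {N : ℕ} (u : Fin N → V) :
    (Fin N → ℕ) × (Fin N → ℕ) :=
  (rank u, fun i => G.degree (u i))

/-- The concatenation of the first `L` positions of each of `M` paths. -/
def concatPaths {M : ℕ} (L : ℕ) (w : Fin M → ℕ → V) : Fin (M * L) → V :=
  fun p => w (finProdFinEquiv.symm p).1 ((finProdFinEquiv.symm p).2 : ℕ)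

end LazyWalk

end

/-! Everything rests on reversibility and spectral decomposition. After `tUnif`, write `P^i(x,u) =
π(u)(1 + ε_i(u))` with `|ε_i| ≤ 1/4`. Each `ε_i` has `π`-mean zero, so in `∑ P^i(x,u) P^j(x,u) / deg
u` only the product `ε_i ε_j` disturbs `1/2m`, by a relative error of at most `1/16`. This sharper
form of the first moment is what the concentration step needs: a lower factor of `9/16` would be too
weak for accuracy `1/2`.

For the second moment, two-point probabilities after `tUnif` are at most `5/4 · π(u) P^|i-k|(u,w)`.
Multiplying the bounds for the two walks and using reversibility turns the sum over positions into
the trace of a power of `P`. Summing over times leaves `4t² ∑_z (∑_{a<t} λ_z^a)²`, up to a factor of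
order `1/m²`. The top eigenvalue gives `t²`, and the others at most `∑ (1-λ_z)⁻² ≤ t_rel ∑
(1-λ_z)⁻¹`.

The core is `IsSpectralBasis.sum_inv_gap_le`: `∑ (1-λ_z)⁻¹ = O(n T^{2/3})` with `T = t_rel`. This
sum is `∑_u deg(u) y(u)`, where `y(u)` is the peak of the centred Green function `f` at `u`. Such an
`f` has mean zero, energy `4y` and squared norm at most `T y`. If `f ≥ y/2` on a ball of radius
`2s`, the norm bound limits the volume of the ball, and double counting gives a total of order
`nT/s`. Otherwise `f` drops by `y/2` along a path of length at most `2s`, so `y = O(s)`; examining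
the neighbours of `u` then gives a total of order `n(1 + T/R + sR)` for any degree threshold `R`.
Both are balanced at `s ≈ R ≈ T^{1/3}`.

Chebyshev's inequality for the sum over `K` independent pairs concludes. Ranks and degrees determine
the estimator, because ranks decide equality of vertices. -/

noncomputable section

namespace LazyWalk

/-! ### Reversibility, the Dirichlet form, and an eigenbasis by symmetrization. -/

section Spectral

set_option linter.unusedSectionVars false

variable {V : Type*} [Fintype V] [DecidableEq V] (G : SimpleGraph V) [DecidableRel G.Adj]

lemma transition_apply (u w : V) : transition G u w =
    (if u = w then 1 / 2 else 0) + (if G.Adj u w then 1 / (2 * (G.degree u : ℝ)) else 0) := rfl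

lemma sum_adj (u : V) (f : V → ℝ) :
    ∑ w, (if G.Adj u w then f w else 0) = ∑ w ∈ G.neighborFinset u, f w := by
  rw [← Finset.sum_filter]
  congr 1
  ext w
  simp

lemma sum_adj_one (u : V) : ∑ w, (if G.Adj u w then (1 : ℝ) else 0) = G.degree u := by
  rw [sum_adj]
  simp

variable {G}

lemma degree_pos [Nontrivial V] (hG : G.Connected) (u : V) : 0 < (G.degree u : ℝ) := by
  exact_mod_cast hG.preconnected.degree_pos_of_nontrivial u

variable (G) in
lemma sum_degree : ∑ u, (G.degree u : ℝ) = 2 * numEdges G := by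
  have := G.sum_degrees_eq_twice_card_edges
  unfold numEdges
  exact_mod_cast this

lemma numEdges_pos [Nontrivial V] (hG : G.Connected) : 0 < (numEdges G : ℝ) := by
  have h := sum_degree G
  have : 0 < ∑ u, (G.degree u : ℝ) := Finset.sum_pos (fun u _ => degree_pos hG u) Finset.univ_nonempty
  linarith

lemma degree_mul_transition [Nontrivial V] (hG : G.Connected) (u w : V) :
    (G.degree u : ℝ) * transition G u w =
      (if u = w then (G.degree u : ℝ) / 2 else 0) + (if G.Adj u w then 1 / 2 else 0) := by
  have := (degree_pos hG u).ne'
  rw [transition_apply]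
  split_ifs <;> field_simp <;> ring

lemma transition_mulVec (f : V → ℝ) (u : V) :
    (transition G).mulVec f u = ∑ w, transition G u w * f w := rfl

lemma degree_mul_mulVec [Nontrivial V] (hG : G.Connected) (f : V → ℝ) (u : V) :
    (G.degree u : ℝ) * (transition G).mulVec f u =
      G.degree u * f u / 2 + (∑ w, if G.Adj u w then f w else 0) / 2 := by
  rw [transition_mulVec, Finset.mul_sum]
  simp_rw [← mul_assoc, degree_mul_transition hG, add_mul, Finset.sum_add_distrib, ite_mul,
    zero_mul]
  rw [Finset.sum_ite_eq, Finset.sum_div]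
  simp only [Finset.mem_univ, if_true]
  congr 1
  · ring
  · exact Finset.sum_congr rfl fun w _ => by split_ifs <;> ring

variable (G) in
/-- Twice the sum over (unoriented) edges of the squared increment. -/
def energy (f : V → ℝ) : ℝ := ∑ u, ∑ w, if G.Adj u w then (f u - f w) ^ 2 else 0

lemma sum_sum_adj_sq (f : V → ℝ) :
    ∑ u, ∑ w, (if G.Adj u w then f u ^ 2 else 0) = ∑ u, (G.degree u : ℝ) * f u ^ 2 := by
  refine Finset.sum_congr rfl fun u _ => ?_
  rw [← sum_adj_one, Finset.sum_mul]
  exact Finset.sum_congr rfl fun w _ => by split_ifs <;> ring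

lemma sum_sum_adj_sq' (f : V → ℝ) :
    ∑ u, ∑ w, (if G.Adj u w then f w ^ 2 else 0) = ∑ u, (G.degree u : ℝ) * f u ^ 2 := by
  rw [← sum_sum_adj_sq, Finset.sum_comm]
  simp only [G.adj_comm]

lemma sum_degree_mul_mulVec [Nontrivial V] (hG : G.Connected) (f : V → ℝ) :
    ∑ u, (G.degree u : ℝ) * (f u * (transition G).mulVec f u) =
      (∑ u, (G.degree u : ℝ) * f u ^ 2) / 2 +
        (∑ u, ∑ w, if G.Adj u w then f u * f w else 0) / 2 := by
  rw [Finset.sum_div, Finset.sum_div, ← Finset.sum_add_distrib]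
  refine Finset.sum_congr rfl fun u _ => ?_
  rw [mul_left_comm, degree_mul_mulVec hG, mul_add, ← mul_div_assoc, ← mul_div_assoc, Finset.mul_sum]
  congr 1
  · ring
  · congr 1
    exact Finset.sum_congr rfl fun w _ => by split_ifs <;> ring

/-- The factor `4` combines the two orientations of each edge with the laziness, which halves the
Dirichlet form of the simple walk. -/
lemma energy_eq [Nontrivial V] (hG : G.Connected) (f : V → ℝ) :
    energy G f =
      4 * ∑ u, (G.degree u : ℝ) * (f u * (f u - (transition G).mulVec f u)) := by
  have h1 : energy G f = ∑ u, (G.degree u : ℝ) * f u ^ 2 + ∑ u, (G.degree u : ℝ) * f u ^ 2 -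
      2 * ∑ u, ∑ w, (if G.Adj u w then f u * f w else 0) := by
    conv_rhs => enter [1, 1]; rw [← sum_sum_adj_sq]
    conv_rhs => enter [1, 2]; rw [← sum_sum_adj_sq']
    simp only [energy, Finset.mul_sum, ← Finset.sum_add_distrib, ← Finset.sum_sub_distrib]
    refine Finset.sum_congr rfl fun u _ => Finset.sum_congr rfl fun w _ => ?_
    split_ifs <;> ring
  have h2 := sum_degree_mul_mulVec hG f
  have h3 : ∑ u, (G.degree u : ℝ) * (f u * (f u - (transition G).mulVec f u)) =
      ∑ u, (G.degree u : ℝ) * f u ^ 2 -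
        ∑ u, (G.degree u : ℝ) * (f u * (transition G).mulVec f u) := by
    rw [← Finset.sum_sub_distrib]
    exact Finset.sum_congr rfl fun u _ => by ring
  rw [h3, h1, h2]
  ring

lemma energy_nonneg (f : V → ℝ) : 0 ≤ energy G f :=
  Finset.sum_nonneg fun u _ => Finset.sum_nonneg fun w _ => by split_ifs <;> positivity

/-- This is where laziness enters: the form is a quarter of the sum of `(f u + f w)²` over ordered
adjacent pairs, so no eigenvalue is negative. -/
lemma sum_degree_mul_mulVec_nonneg [Nontrivial V] (hG : G.Connected) (f : V → ℝ) :
    0 ≤ ∑ u, (G.degree u : ℝ) * (f u * (transition G).mulVec f u) := by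
  have h0 : 0 ≤ ∑ u, ∑ w, if G.Adj u w then (f u + f w) ^ 2 else 0 :=
    Finset.sum_nonneg fun u _ => Finset.sum_nonneg fun w _ => by split_ifs <;> positivity
  have h1 : ∑ u, ∑ w, (if G.Adj u w then (f u + f w) ^ 2 else 0) =
      ∑ u, (G.degree u : ℝ) * f u ^ 2 + ∑ u, (G.degree u : ℝ) * f u ^ 2 +
      2 * ∑ u, ∑ w, (if G.Adj u w then f u * f w else 0) := by
    conv_rhs => enter [1, 1]; rw [← sum_sum_adj_sq]
    conv_rhs => enter [1, 2]; rw [← sum_sum_adj_sq']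
    simp only [Finset.mul_sum, ← Finset.sum_add_distrib]
    refine Finset.sum_congr rfl fun u _ => Finset.sum_congr rfl fun w _ => ?_
    split_ifs <;> ring
  have h2 := sum_degree_mul_mulVec hG f
  linarith

/-- A function of zero energy on a connected graph is constant. -/
lemma eq_of_energy_eq_zero (hG : G.Connected) {f : V → ℝ} (hf : energy G f = 0) (u w : V) :
    f u = f w := by
  have hadj : ∀ a b, G.Adj a b → f a = f b := by
    intro a b hab
    have h1 := (Finset.sum_eq_zero_iff_of_nonneg (fun u _ => Finset.sum_nonneg fun w _ => by
      split_ifs <;> positivity)).1 hf a (Finset.mem_univ _)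
    have h2 := (Finset.sum_eq_zero_iff_of_nonneg (fun w _ => by
      split_ifs <;> positivity)).1 h1 b (Finset.mem_univ _)
    rw [if_pos hab] at h2
    exact sub_eq_zero.1 (pow_eq_zero_iff two_ne_zero |>.1 h2)
  obtain ⟨p⟩ := hG.preconnected u w
  induction p with
  | nil => rfl
  | cons h _ ih => exact (hadj _ _ h).trans ih

variable (G) in
/-- A basis of eigenfunctions of the transition matrix, orthonormal with respect to the degree
measure, indexed by the vertices. -/
structure IsEigenbasis (lam : V → ℝ) (g : V → V → ℝ) : Prop where
  orth : ∀ i j, ∑ u, (G.degree u : ℝ) * (g i u * g j u) = if i = j then 1 else 0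
  eigen : ∀ i u, (transition G).mulVec (g i) u = lam i * g i u
  complete : ∀ u w, ∑ i, g i u * g i w * (G.degree w : ℝ) = if u = w then 1 else 0

variable (G) in
/-- The symmetrized transition matrix. -/
def symmetrized : Matrix V V ℝ :=
  Matrix.of fun u w => √(G.degree u : ℝ) * transition G u w * (√(G.degree w : ℝ))⁻¹

lemma symmetrized_apply [Nontrivial V] (hG : G.Connected) (u w : V) : symmetrized G u w =
    (if u = w then 1 / 2 else 0) +
      (if G.Adj u w then 1 / (2 * √(G.degree u : ℝ) * √(G.degree w : ℝ)) else 0) := by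
  have hu := Real.sqrt_pos.2 (degree_pos hG u)
  have hw := Real.sqrt_pos.2 (degree_pos hG w)
  have key : ∀ a b D : ℝ, 0 < a → 0 < b → a * a = D →
      a * (0 + 1 / (2 * D)) * b⁻¹ = 0 + 1 / (2 * a * b) := by
    rintro a b D ha hb rfl
    field_simp
    ring
  simp only [symmetrized, Matrix.of_apply, transition_apply]
  rcases eq_or_ne u w with rfl | h
  · simp only [if_true, SimpleGraph.irrefl, if_false]
    field_simp
  · simp only [h, if_false]
    split_ifs
    · exact key _ _ _ hu hw (Real.mul_self_sqrt (degree_pos hG u).le)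
    · simp

lemma symmetrized_isHermitian [Nontrivial V] (hG : G.Connected) :
    (symmetrized G).IsHermitian := by
  ext u w
  simp only [Matrix.conjTranspose_apply, star_trivial, symmetrized_apply hG, G.adj_comm w u,
    eq_comm (a := w) (b := u)]
  congr 2
  ring

/-- Conjugation by the diagonal matrix of `√deg` is a similarity. The sorted spectrum of the
Hermitian matrix is therefore the list that defines `lambdaTwo`. -/
lemma symmetrized_charpoly [Nontrivial V] (hG : G.Connected) :
    (symmetrized G).charpoly = (transition G).charpoly := by
  have hne : ∀ u, √(G.degree u : ℝ) ≠ 0 := fun u => (Real.sqrt_pos.2 (degree_pos hG u)).ne'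
  let D : (Matrix V V ℝ)ˣ :=
    ⟨Matrix.diagonal fun u => √(G.degree u : ℝ), Matrix.diagonal fun u => (√(G.degree u : ℝ))⁻¹,
      by simp [Matrix.diagonal_mul_diagonal, hne], by simp [Matrix.diagonal_mul_diagonal, hne]⟩
  have h := Matrix.charpoly_units_conj D (transition G)
  rw [← h, ← Matrix.coe_units_inv]
  congr 1
  ext u w
  simp [D, symmetrized, Matrix.mul_diagonal, Matrix.diagonal_mul]

/-- The eigenvalues form a decreasing family along an enumeration of the vertices whose second
member is `lambdaTwo`. -/
theorem exists_eigenbasis [Nontrivial V] (hG : G.Connected) :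
    ∃ (lam : V → ℝ) (g : V → V → ℝ) (q₀ q₁ : V), IsEigenbasis G lam g ∧ q₀ ≠ q₁ ∧
      lam q₁ = lambdaTwo G ∧ (∀ i, lam i ≤ lam q₀) ∧ ∀ i, i ≠ q₀ → lam i ≤ lam q₁ := by
  have hS := symmetrized_isHermitian hG
  have hd := degree_pos hG
  have hne : ∀ u, √(G.degree u : ℝ) ≠ 0 := fun u => (Real.sqrt_pos.2 (hd u)).ne'
  have hsq : ∀ u, √(G.degree u : ℝ) * √(G.degree u : ℝ) = G.degree u :=
    fun u => Real.mul_self_sqrt (hd u).le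
  have hcard : 1 < Fintype.card V := Fintype.one_lt_card
  -- This has to be the enumeration by which `eigenvalues` is defined from `eigenvalues₀`; `hlam`
  -- then holds by `rfl`.
  let e : Fin (Fintype.card V) ≃ V := Fintype.equivOfCardEq (Fintype.card_fin _)
  have hlam : ∀ i, hS.eigenvalues i = hS.eigenvalues₀ (e.symm i) := fun i => rfl
  have hlist : eigenvalueList G = List.ofFn hS.eigenvalues₀ := by
    rw [← hS.sort_roots_charpoly_eq_eigenvalues₀, symmetrized_charpoly hG, eigenvalueList]
    simp
  have hl2 : lambdaTwo G = hS.eigenvalues₀ ⟨1, hcard⟩ := by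
    rw [lambdaTwo, hlist, List.getD_eq_getElem _ _ (by simpa using hcard)]
    simp
  let b := hS.eigenvectorBasis
  refine ⟨hS.eigenvalues, fun i u => b i u * (√(G.degree u : ℝ))⁻¹, e ⟨0, by omega⟩, e ⟨1, hcard⟩,
    ⟨?_, ?_, ?_⟩, ?_, ?_, ?_, ?_⟩
  · intro i j
    have h := orthonormal_iff_ite.1 b.orthonormal i j
    rw [← h, PiLp.inner_apply]
    refine Finset.sum_congr rfl fun u _ => ?_
    simp only [RCLike.inner_apply, conj_trivial]
    have key : ∀ a D x y : ℝ, a ≠ 0 → a * a = D → D * (x * a⁻¹ * (y * a⁻¹)) = y * x := by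
      rintro a D x y ha rfl
      field_simp
    exact key _ _ _ _ (hne u) (hsq u)
  · intro i u
    have h := congrFun (hS.mulVec_eigenvectorBasis i) u
    simp only [Matrix.mulVec, dotProduct, Pi.smul_apply, smul_eq_mul, symmetrized,
      Matrix.of_apply] at h
    rw [transition_mulVec, ← mul_assoc]
    refine Eq.trans ?_ (congrArg (· * (√(G.degree u : ℝ))⁻¹) h)
    simp only
    rw [Finset.sum_mul]
    refine Finset.sum_congr rfl fun w _ => ?_
    have := hne u
    field_simp
    rfl
  · intro u w
    have h := b.sum_inner_mul_inner (EuclideanSpace.single u 1) (EuclideanSpace.single w 1)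
    simp only [EuclideanSpace.inner_single_left, EuclideanSpace.inner_single_right,
      conj_trivial, one_mul, map_one] at h
    have h' : (EuclideanSpace.single u (1 : ℝ)) w = if u = w then 1 else 0 := by
      simp [eq_comm]
    rw [h'] at h
    have h2 : ∑ i, b i u * (√(G.degree u : ℝ))⁻¹ * (b i w * (√(G.degree w : ℝ))⁻¹) *
        (G.degree w : ℝ) = (√(G.degree u : ℝ))⁻¹ * √(G.degree w : ℝ) * ∑ i, b i u * b i w := by
      rw [Finset.mul_sum]
      refine Finset.sum_congr rfl fun i _ => ?_
      have key : ∀ a b D x y : ℝ, a ≠ 0 → b ≠ 0 → b * b = D →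
          x * a⁻¹ * (y * b⁻¹) * D = a⁻¹ * b * (x * y) := by
        rintro a b D x y ha hb rfl
        field_simp
      exact key _ _ _ _ _ (hne u) (hne w) (hsq w)
    rw [h2, h]
    split_ifs with huw
    · subst huw
      have := hne u
      field_simp
    · simp
  · simp
  · rw [hlam, hl2, Equiv.symm_apply_apply]
  · intro i
    rw [hlam, hlam, Equiv.symm_apply_apply]
    exact hS.eigenvalues₀_antitone (Fin.mk_le_of_le_val (Nat.zero_le _))
  · intro i hi
    rw [hlam, hlam, Equiv.symm_apply_apply]
    refine hS.eigenvalues₀_antitone (Fin.mk_le_of_le_val ?_)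
    rw [Nat.one_le_iff_ne_zero]
    exact fun h => hi ((e.symm_apply_eq).1 (Fin.ext h))

end Spectral

/-! ### The simple eigenvalue 1, spectral expansion of powers, and mixing. -/

section SpectralGap

set_option linter.unusedSectionVars false

variable {V : Type*} [Fintype V] [DecidableEq V] {G : SimpleGraph V} [DecidableRel G.Adj]
  {lam : V → ℝ} {g : V → V → ℝ}

lemma IsEigenbasis.sum_degree_mul_mulVec (h : IsEigenbasis G lam g) (i j : V) :
    ∑ u, (G.degree u : ℝ) * (g i u * (transition G).mulVec (g j) u) =
      if i = j then lam i else 0 := by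
  simp_rw [h.eigen]
  have : ∑ u, (G.degree u : ℝ) * (g i u * (lam j * g j u)) =
      lam j * ∑ u, (G.degree u : ℝ) * (g i u * g j u) := by
    rw [Finset.mul_sum]
    exact Finset.sum_congr rfl fun u _ => by ring
  rw [this, h.orth]
  split_ifs with hij
  · rw [hij, mul_one]
  · simp

lemma IsEigenbasis.nonneg [Nontrivial V] (hG : G.Connected) (h : IsEigenbasis G lam g) (i : V) :
    0 ≤ lam i := by
  have := sum_degree_mul_mulVec_nonneg hG (g i)
  rwa [h.sum_degree_mul_mulVec, if_pos rfl] at this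

lemma IsEigenbasis.energy [Nontrivial V] (hG : G.Connected) (h : IsEigenbasis G lam g) (i : V) :
    energy G (g i) = 4 * (1 - lam i) := by
  rw [energy_eq hG]
  have h1 := h.sum_degree_mul_mulVec i i
  have h2 := h.orth i i
  rw [if_pos rfl] at h1 h2
  simp_rw [mul_sub, Finset.sum_sub_distrib]
  rw [h1, h2]
  ring

lemma IsEigenbasis.le_one [Nontrivial V] (hG : G.Connected) (h : IsEigenbasis G lam g) (i : V) :
    lam i ≤ 1 := by
  have h1 := h.energy hG i
  have h2 := energy_nonneg (G := G) (g i)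
  linarith

lemma IsEigenbasis.const_of_eq_one [Nontrivial V] (hG : G.Connected) (h : IsEigenbasis G lam g)
    {i : V} (hi : lam i = 1) (u w : V) : g i u = g i w := by
  refine eq_of_energy_eq_zero hG ?_ u w
  rw [h.energy hG, hi]
  ring

lemma IsEigenbasis.sq_of_eq_one [Nontrivial V] (hG : G.Connected) (h : IsEigenbasis G lam g)
    {i : V} (hi : lam i = 1) (u : V) : g i u ^ 2 = 1 / (2 * numEdges G) := by
  have h1 := h.orth i i
  rw [if_pos rfl] at h1
  simp_rw [fun w => h.const_of_eq_one hG hi w u, ← Finset.sum_mul] at h1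
  rw [sum_degree] at h1
  have := numEdges_pos hG
  rw [eq_div_iff (by positivity), ← h1]
  ring

/-- An eigenfunction for the eigenvalue `1` has zero energy, hence is constant and nonzero; two such
functions cannot be orthogonal. Simplicity of `1` gives `lambdaTwo G < 1`. -/
lemma IsEigenbasis.eq_of_eq_one [Nontrivial V] (hG : G.Connected) (h : IsEigenbasis G lam g)
    {i j : V} (hi : lam i = 1) (hj : lam j = 1) : i = j := by
  by_contra hij
  have h1 := h.orth i j
  obtain ⟨x⟩ : Nonempty V := inferInstance
  rw [if_neg hij] at h1
  simp_rw [fun w => h.const_of_eq_one hG hi w x, fun w => h.const_of_eq_one hG hj w x,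
    ← Finset.sum_mul] at h1
  rw [sum_degree] at h1
  have hm := numEdges_pos hG
  have h2 := h.sq_of_eq_one hG hi x
  have h3 := h.sq_of_eq_one hG hj x
  have h4 : 0 < 1 / (2 * (numEdges G : ℝ)) := by positivity
  rw [← h2] at h4
  have h5 : 0 < 1 / (2 * (numEdges G : ℝ)) := by positivity
  rw [← h3] at h5
  rcases mul_eq_zero.1 h1 with h6 | h6
  · linarith
  · rcases mul_eq_zero.1 h6 with h7 | h7 <;> simp [h7] at h4 h5

lemma transition_sum [Nontrivial V] (hG : G.Connected) (u : V) : ∑ w, transition G u w = 1 := by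
  have h := degree_mul_mulVec hG (fun _ => 1) u
  simp only [transition_mulVec, mul_one, sum_adj_one] at h
  have := degree_pos hG u
  field_simp at h
  linarith

/-- The degree measure is invariant, so an eigenfunction with eigenvalue other than `1` has mean
zero. If all were of this kind, summing the completeness relation over its second point would give
`0 = 1`. -/
lemma IsEigenbasis.exists_eq_one [Nontrivial V] (hG : G.Connected) (h : IsEigenbasis G lam g) :
    ∃ i, lam i = 1 := by
  by_contra! hne
  obtain ⟨x⟩ : Nonempty V := inferInstance
  have hz : ∀ i, ∑ w, g i w * (G.degree w : ℝ) = 0 := by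
    intro i
    have h1 : ∑ u, (G.degree u : ℝ) * (transition G).mulVec (g i) u =
        ∑ u, g i u * (G.degree u : ℝ) := by
      simp_rw [degree_mul_mulVec hG, Finset.sum_add_distrib, ← Finset.sum_div]
      rw [Finset.sum_comm]
      have : ∀ w, ∑ u, (if G.Adj u w then g i w else 0) = g i w * G.degree w := by
        intro w
        rw [← sum_adj_one, Finset.mul_sum]
        refine Finset.sum_congr rfl fun u _ => ?_
        simp [G.adj_comm]
      simp_rw [this, mul_comm (G.degree _ : ℝ)]
      ring
    simp_rw [h.eigen] at h1
    have h2 : ∑ u, (G.degree u : ℝ) * (lam i * g i u) =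
        lam i * ∑ u, g i u * (G.degree u : ℝ) := by
      rw [Finset.mul_sum]
      exact Finset.sum_congr rfl fun u _ => by ring
    rw [h2] at h1
    have h3 : (lam i - 1) * ∑ u, g i u * (G.degree u : ℝ) = 0 := by linarith
    exact (mul_eq_zero.1 h3).resolve_left (sub_ne_zero.2 (hne i))
  have h1 : ∑ w, ∑ i, g i x * g i w * (G.degree w : ℝ) = 1 := by
    simp_rw [h.complete]
    simp
  rw [Finset.sum_comm] at h1
  simp_rw [mul_assoc, ← Finset.mul_sum, hz] at h1
  simp at h1

variable (G) in
/-- An eigenbasis in which the constant eigenfunction is singled out. -/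
structure IsSpectralBasis (lam : V → ℝ) (g : V → V → ℝ) (q₀ : V) : Prop
    extends IsEigenbasis G lam g where
  nonneg : ∀ i, 0 ≤ lam i
  top : lam q₀ = 1
  const : ∀ u w, g q₀ u = g q₀ w
  sq : ∀ u, g q₀ u ^ 2 = 1 / (2 * numEdges G)
  le_two : ∀ i, i ≠ q₀ → lam i ≤ lambdaTwo G
  two_lt : lambdaTwo G < 1

theorem exists_spectralBasis [Nontrivial V] (hG : G.Connected) :
    ∃ (lam : V → ℝ) (g : V → V → ℝ) (q₀ : V), IsSpectralBasis G lam g q₀ := by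
  obtain ⟨lam, g, q₀, q₁, h, hne, h2, h0, h1⟩ := exists_eigenbasis hG
  have htop : lam q₀ = 1 := by
    obtain ⟨i, hi⟩ := h.exists_eq_one hG
    exact le_antisymm (h.le_one hG _) (hi ▸ h0 i)
  refine ⟨lam, g, q₀, h, h.nonneg hG, htop, h.const_of_eq_one hG htop, h.sq_of_eq_one hG htop,
    h2 ▸ h1, ?_⟩
  rw [← h2]
  exact lt_of_le_of_ne (h.le_one hG _) fun h3 => hne (h.eq_of_eq_one hG htop h3)

variable {q₀ : V}

lemma IsSpectralBasis.lt_one (h : IsSpectralBasis G lam g q₀) {i : V} (hi : i ≠ q₀) :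
    lam i < 1 := (h.le_two i hi).trans_lt h.two_lt

lemma IsEigenbasis.pow_mulVec (h : IsEigenbasis G lam g) (s : ℕ) (i u : V) :
    ∑ w, (transition G ^ s) u w * g i w = lam i ^ s * g i u := by
  induction s generalizing u with
  | zero => simp [Matrix.one_apply]
  | succ s ih =>
    simp_rw [pow_succ', Matrix.mul_apply, Finset.sum_mul]
    rw [Finset.sum_comm]
    simp_rw [mul_assoc, ← Finset.mul_sum, ih]
    have := h.eigen i u
    rw [transition_mulVec] at this
    calc ∑ x, transition G u x * (lam i ^ s * g i x)
        = lam i ^ s * ∑ x, transition G u x * g i x := by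
          rw [Finset.mul_sum]
          exact Finset.sum_congr rfl fun x _ => by ring
      _ = _ := by rw [this]; ring

/-- The spectral expansion of the `s`-step transition probabilities. -/
lemma IsEigenbasis.pow_apply (h : IsEigenbasis G lam g) (s : ℕ) (u w : V) :
    (transition G ^ s) u w = ∑ i, lam i ^ s * (g i u * g i w * (G.degree w : ℝ)) := by
  have h1 : (transition G ^ s) u w =
      ∑ v, (transition G ^ s) u v * ∑ i, g i v * g i w * (G.degree w : ℝ) := by
    simp_rw [h.complete]
    simp
  rw [h1]
  simp_rw [Finset.mul_sum]
  rw [Finset.sum_comm]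
  refine Finset.sum_congr rfl fun i _ => ?_
  calc ∑ v, (transition G ^ s) u v * (g i v * g i w * (G.degree w : ℝ))
      = (∑ v, (transition G ^ s) u v * g i v) * (g i w * (G.degree w : ℝ)) := by
        rw [Finset.sum_mul]
        exact Finset.sum_congr rfl fun v _ => by ring
    _ = _ := by rw [h.pow_mulVec]; ring

lemma IsEigenbasis.trace_pow (h : IsEigenbasis G lam g) (s : ℕ) :
    (transition G ^ s).trace = ∑ i, lam i ^ s := by
  simp_rw [Matrix.trace, Matrix.diag_apply, h.pow_apply]
  rw [Finset.sum_comm]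
  refine Finset.sum_congr rfl fun i _ => ?_
  have := h.orth i i
  rw [if_pos rfl] at this
  rw [← Finset.mul_sum, ← mul_one (lam i ^ s), mul_assoc, one_mul, ← this]
  congr 1
  exact Finset.sum_congr rfl fun u _ => by ring

/-- Detailed balance for all powers is read off the spectral expansion, whose terms become symmetric
in the two points once multiplied by the degree. -/
lemma degree_mul_pow_symm [Nontrivial V] (hG : G.Connected) (s : ℕ) (u w : V) :
    (G.degree u : ℝ) * (transition G ^ s) u w = G.degree w * (transition G ^ s) w u := by
  obtain ⟨lam, g, q₀, h⟩ := exists_spectralBasis hG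
  rw [h.pow_apply, h.pow_apply, Finset.mul_sum, Finset.mul_sum]
  exact Finset.sum_congr rfl fun i _ => by ring

lemma transition_nonneg (u w : V) : 0 ≤ transition G u w := by
  rw [transition_apply]
  split_ifs <;> positivity

lemma transition_pow_nonneg (s : ℕ) (u w : V) : 0 ≤ (transition G ^ s) u w := by
  induction s generalizing u with
  | zero =>
    rw [pow_zero, Matrix.one_apply]
    split_ifs <;> norm_num
  | succ s ih =>
    rw [pow_succ', Matrix.mul_apply]
    exact Finset.sum_nonneg fun v _ => mul_nonneg (transition_nonneg _ _) (ih v)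

lemma pow_sum [Nontrivial V] (hG : G.Connected) (s : ℕ) (u : V) :
    ∑ w, (transition G ^ s) u w = 1 := by
  induction s generalizing u with
  | zero => simp [Matrix.one_apply]
  | succ s ih =>
    simp_rw [pow_succ', Matrix.mul_apply]
    rw [Finset.sum_comm]
    simp_rw [← Finset.mul_sum, ih, mul_one]
    exact transition_sum hG u

lemma stationary_pos [Nontrivial V] (hG : G.Connected) (u : V) : 0 < stationary G u := by
  have := degree_pos hG u
  have := numEdges_pos hG
  unfold stationary
  positivity

lemma stationary_sum [Nontrivial V] (hG : G.Connected) : ∑ u, stationary G u = 1 := by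
  have := numEdges_pos hG
  simp_rw [stationary, ← Finset.sum_div, sum_degree]
  exact div_self (by positivity)

lemma stationary_mul_pow_symm [Nontrivial V] (hG : G.Connected) (s : ℕ) (u w : V) :
    stationary G u * (transition G ^ s) u w = stationary G w * (transition G ^ s) w u := by
  have := degree_mul_pow_symm hG s u w
  unfold stationary
  rw [div_mul_eq_mul_div, this]
  ring

lemma IsSpectralBasis.pow_div_stationary [Nontrivial V] (hG : G.Connected)
    (h : IsSpectralBasis G lam g q₀) (s : ℕ) (u w : V) :
    (transition G ^ s) u w / stationary G w - 1 =
      2 * numEdges G * ∑ i ∈ Finset.univ.erase q₀, lam i ^ s * (g i u * g i w) := by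
  have hd := degree_pos hG w
  have hm := numEdges_pos hG
  have h1 := h.sq w
  rw [h.pow_apply, ← Finset.add_sum_erase _ _ (Finset.mem_univ q₀), h.top, h.const u w,
    ← pow_two (g q₀ w), h1, stationary]
  simp_rw [← mul_assoc, ← Finset.sum_mul]
  field_simp
  ring

/-- The lazy walk mixes. -/
lemma mixing_nonempty [Nontrivial V] (hG : G.Connected) :
    {t : ℕ | ∀ x y : V, |(transition G ^ t) x y / stationary G y - 1| ≤ 1 / 4}.Nonempty := by
  obtain ⟨lam, g, q₀, h⟩ := exists_spectralBasis hG
  have hlim : ∀ x y : V, Filter.Tendsto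
      (fun t : ℕ => |(transition G ^ t) x y / stationary G y - 1|) Filter.atTop (nhds 0) := by
    intro x y
    rw [← abs_zero]
    refine Filter.Tendsto.abs ?_
    simp_rw [h.pow_div_stationary hG]
    have : Filter.Tendsto (fun t : ℕ => 2 * (numEdges G : ℝ) *
        ∑ i ∈ Finset.univ.erase q₀, lam i ^ t * (g i x * g i y)) Filter.atTop
        (nhds (2 * (numEdges G : ℝ) * ∑ i ∈ Finset.univ.erase q₀, 0 * (g i x * g i y))) := by
      refine Filter.Tendsto.const_mul _ (tendsto_finsetSum _ fun i hi => ?_)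
      exact (tendsto_pow_atTop_nhds_zero_of_lt_one (h.nonneg i)
        (h.lt_one (Finset.ne_of_mem_erase hi))).mul_const _
    simpa using this
  have hev : ∀ᶠ t in Filter.atTop, ∀ x y : V,
      |(transition G ^ t) x y / stationary G y - 1| ≤ 1 / 4 := by
    simp only [Filter.eventually_all]
    exact fun x y => (hlim x y).eventually_le_const (by norm_num)
  exact hev.exists

/-- The row of `P^(t+1)` at `x` is an average of rows of `P^t`, so the maximal relative error never
grows. The base case needs `mixing_nonempty`, since the infimum of an empty set of naturals would be
`0`. -/
lemma mixing_of_tUnif_le [Nontrivial V] (hG : G.Connected) {t : ℕ} (ht : tUnif G ≤ t) (x y : V) :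
    |(transition G ^ t) x y / stationary G y - 1| ≤ 1 / 4 := by
  induction t, ht using Nat.le_induction generalizing x with
  | base => exact Nat.sInf_mem (mixing_nonempty hG) x y
  | succ t _ ih =>
    have h1 : (transition G ^ (t + 1)) x y / stationary G y - 1 =
        ∑ v, transition G x v * ((transition G ^ t) v y / stationary G y - 1) := by
      simp_rw [mul_sub, Finset.sum_sub_distrib, mul_one, transition_sum hG, pow_succ',
        Matrix.mul_apply, Finset.sum_div, mul_div_assoc]
    rw [h1]
    calc |∑ v, transition G x v * ((transition G ^ t) v y / stationary G y - 1)|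
        ≤ ∑ v, |transition G x v * ((transition G ^ t) v y / stationary G y - 1)| :=
          Finset.abs_sum_le_sum_abs _ _
      _ ≤ ∑ v, transition G x v * (1 / 4) := by
          refine Finset.sum_le_sum fun v _ => ?_
          rw [abs_mul, abs_of_nonneg (transition_nonneg _ _)]
          exact mul_le_mul_of_nonneg_left (ih v) (transition_nonneg _ _)
      _ = 1 / 4 := by rw [← Finset.sum_mul, transition_sum hG, one_mul]

lemma pow_le_of_tUnif_le [Nontrivial V] (hG : G.Connected) {t : ℕ} (ht : tUnif G ≤ t) (x y : V) :
    (transition G ^ t) x y ≤ 5 / 4 * stationary G y := by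
  have h1 := (abs_le.1 (mixing_of_tUnif_le hG ht x y)).2
  have h2 := stationary_pos hG y
  have h3 : (transition G ^ t) x y / stationary G y ≤ 5 / 4 := by linarith
  rwa [div_le_iff₀ h2] at h3

lemma one_le_tRel [Nontrivial V] (hG : G.Connected) : 1 ≤ (tRel G : ℝ) := by
  obtain ⟨lam, g, q₀, h⟩ := exists_spectralBasis hG
  have h1 := h.two_lt
  have : 0 < 1 / (1 - lambdaTwo G) := by
    have : 0 < 1 - lambdaTwo G := by linarith
    positivity
  exact_mod_cast Nat.ceil_pos.2 this

lemma IsSpectralBasis.inv_gap_le (h : IsSpectralBasis G lam g q₀) {i : V} (hi : i ≠ q₀) :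
    (1 - lam i)⁻¹ ≤ tRel G := by
  have h1 := h.le_two i hi
  have h2 := h.two_lt
  calc (1 - lam i)⁻¹ ≤ (1 - lambdaTwo G)⁻¹ := by
        apply inv_anti₀ <;> linarith
    _ = 1 / (1 - lambdaTwo G) := by rw [one_div]
    _ ≤ tRel G := Nat.le_ceil _

end SpectralGap

/-! ### The Green function and the bound on the sum of inverse spectral gaps. -/

section Green

set_option linter.unusedSectionVars false

variable {V : Type*} [Fintype V] [DecidableEq V] {G : SimpleGraph V} [DecidableRel G.Adj]

variable (G) in
/-- The ball for the graph distance. -/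
def ball (u : V) (r : ℕ) : Finset V := Finset.univ.filter fun w => G.dist u w ≤ r

lemma mem_ball {u w : V} {r : ℕ} : w ∈ ball G u r ↔ G.dist u w ≤ r := by
  simp [ball]

variable (G) in
/-- The sum of the degrees over a ball. -/
def ballVol (u : V) (r : ℕ) : ℝ := ∑ w ∈ ball G u r, (G.degree w : ℝ)

lemma ballVol_pos [Nontrivial V] (hG : G.Connected) (u : V) (r : ℕ) : 0 < ballVol G u r :=
  Finset.sum_pos (fun w _ => degree_pos hG w) ⟨u, mem_ball.2 (by simp)⟩

/-- Along a shortest path, the increment of a function is controlled by its energy. -/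
lemma sq_sub_le_dist_mul_energy (hG : G.Connected) (f : V → ℝ) (u w : V) :
    (f u - f w) ^ 2 ≤ G.dist u w * energy G f := by
  obtain ⟨p, hp, hlen⟩ := hG.exists_path_of_dist u w
  have htel : f u - f w = ∑ k ∈ Finset.range p.length, (f (p.getVert k) - f (p.getVert (k + 1))) := by
    rw [Finset.sum_range_sub']
    simp
  have hcs := sq_sum_le_card_mul_sum_sq (s := Finset.range p.length)
    (f := fun k => f (p.getVert k) - f (p.getVert (k + 1)))
  rw [← htel, Finset.card_range, hlen] at hcs
  refine hcs.trans (mul_le_mul_of_nonneg_left ?_ (Nat.cast_nonneg _))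
  -- The path visits distinct vertices, so each row of the energy is charged at most once.
  have hinj : Set.InjOn p.getVert (Finset.range (G.dist u w) : Set ℕ) := by
    refine hp.getVert_injOn.mono fun k hk => ?_
    rw [Finset.coe_range, Set.mem_Iio] at hk
    show k ≤ p.length
    omega
  calc ∑ k ∈ Finset.range (G.dist u w), (f (p.getVert k) - f (p.getVert (k + 1))) ^ 2
      ≤ ∑ k ∈ Finset.range (G.dist u w),
          ∑ z, if G.Adj (p.getVert k) z then (f (p.getVert k) - f z) ^ 2 else 0 := by
        refine Finset.sum_le_sum fun k hk => ?_
        have hadj : G.Adj (p.getVert k) (p.getVert (k + 1)) :=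
          p.adj_getVert_succ (by rw [hlen]; exact Finset.mem_range.1 hk)
        have := Finset.single_le_sum (f := fun z =>
          if G.Adj (p.getVert k) z then (f (p.getVert k) - f z) ^ 2 else 0)
          (fun z _ => by split_ifs <;> positivity) (Finset.mem_univ (p.getVert (k + 1)))
        simpa only [if_pos hadj] using this
    _ = ∑ v ∈ (Finset.range (G.dist u w)).image p.getVert,
          ∑ z, if G.Adj v z then (f v - f z) ^ 2 else 0 := by
        rw [Finset.sum_image hinj]
    _ ≤ energy G f :=
        Finset.sum_le_sum_of_subset_of_nonneg (Finset.subset_univ _) fun v _ _ =>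
          Finset.sum_nonneg fun z _ => by split_ifs <;> positivity

/-- In a connected graph, a ball whose radius does not exceed some distance from its centre has
more vertices than its radius. -/
lemma card_ball_ge (hG : G.Connected) {u w : V} {s : ℕ} (h : s ≤ G.dist u w) :
    s + 1 ≤ (ball G u s).card := by
  obtain ⟨p, hp, hlen⟩ := hG.exists_path_of_dist u w
  have hinj : Set.InjOn p.getVert (Finset.range (s + 1) : Set ℕ) := by
    refine hp.getVert_injOn.mono fun k hk => ?_
    rw [Finset.coe_range, Set.mem_Iio] at hk
    show k ≤ p.length
    omega
  rw [← Finset.card_range (s + 1), ← Finset.card_image_of_injOn hinj]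
  refine Finset.card_le_card fun v hv => ?_
  obtain ⟨k, hk, rfl⟩ := Finset.mem_image.1 hv
  rw [mem_ball]
  have h1 := SimpleGraph.dist_le (p.take k)
  rw [SimpleGraph.Walk.take_length] at h1
  have := Finset.mem_range.1 hk
  omega

/-- Double counting: on average, the degree is a small proportion of the volume of a ball. -/
lemma sum_degree_div_ballVol_le [Nontrivial V] (hG : G.Connected) {s : ℕ}
    (hs : ∀ w, s + 1 ≤ (ball G w s).card) :
    ∑ u, (G.degree u : ℝ) / ballVol G u (2 * s) ≤ Fintype.card V / (s + 1 : ℝ) := by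
  rw [le_div_iff₀ (by positivity), Finset.sum_mul]
  calc ∑ u, (G.degree u : ℝ) / ballVol G u (2 * s) * (s + 1)
      ≤ ∑ u, ∑ w, if G.dist u w ≤ s then (G.degree u : ℝ) / ballVol G u (2 * s) else 0 := by
        refine Finset.sum_le_sum fun u _ => ?_
        rw [← Finset.sum_filter, Finset.sum_const, nsmul_eq_mul, mul_comm]
        have h1 := (ballVol_pos hG u (2 * s)).le
        refine mul_le_mul_of_nonneg_right ?_ (by positivity)
        exact_mod_cast hs u
    -- When `u` and `w` are within `s`, the `s`-ball of `w` lies in the `2s`-ball of `u`. Recentring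
    -- at `w` makes each `w` contribute exactly `1` once the sums are exchanged.
    _ ≤ ∑ u, ∑ w, if G.dist u w ≤ s then (G.degree u : ℝ) / ballVol G w s else 0 := by
        refine Finset.sum_le_sum fun u _ => Finset.sum_le_sum fun w _ => ?_
        split_ifs with h
        · refine div_le_div_of_nonneg_left (Nat.cast_nonneg _) (ballVol_pos hG w s) ?_
          refine Finset.sum_le_sum_of_subset_of_nonneg (fun v hv => ?_)
            fun v _ _ => Nat.cast_nonneg _
          rw [mem_ball] at hv ⊢
          have := hG.dist_triangle (u := u) (v := w) (w := v)
          omega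
        · exact le_rfl
    _ = ∑ w, ∑ u ∈ ball G w s, (G.degree u : ℝ) / ballVol G w s := by
        rw [Finset.sum_comm]
        refine Finset.sum_congr rfl fun w _ => ?_
        rw [ball, Finset.sum_filter]
        simp only [SimpleGraph.dist_comm]
    _ = ∑ w : V, 1 := by
        refine Finset.sum_congr rfl fun w _ => ?_
        rw [← Finset.sum_div]
        exact div_self (ballVol_pos hG w s).ne'
    _ = Fintype.card V := by simp

variable (G) in
/-- The number of neighbours of degree less than `R`. -/
def lowNeighbors (R : ℝ) (u : V) : ℝ :=
  ∑ w, if G.Adj u w then (if (G.degree w : ℝ) < R then 1 else 0) else 0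

/-- Counted from the other endpoint: only vertices of degree below `R` contribute, each at most its
own degree. -/
lemma sum_lowNeighbors_le {R : ℝ} (hR : 0 ≤ R) :
    ∑ u, lowNeighbors G R u ≤ Fintype.card V * R := by
  unfold lowNeighbors
  rw [Finset.sum_comm]
  calc ∑ w, ∑ u, (if G.Adj u w then (if (G.degree w : ℝ) < R then (1 : ℝ) else 0) else 0)
      ≤ ∑ w : V, R := by
        refine Finset.sum_le_sum fun w _ => ?_
        split_ifs with h
        · simp_rw [G.adj_comm _ w, sum_adj_one]
          exact h.le
        · simpa using hR
    _ = _ := by simp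

lemma lowNeighbors_nonneg (R : ℝ) (u : V) : 0 ≤ lowNeighbors G R u :=
  Finset.sum_nonneg fun w _ => by split_ifs <;> norm_num

/-- Either many neighbours see a large increment, or many carry mass, or many have low degree. -/
lemma degree_mul_le_lowNeighbors {f : V → ℝ} {u : V} {y T R : ℝ} (hy : 0 < y) (hR : 0 < R)
    (hfu : f u = y) (hE : energy G f = 4 * y) (hN : ∑ w, (G.degree w : ℝ) * f w ^ 2 ≤ T * y) :
    (G.degree u : ℝ) * y ≤ 16 + 4 * T / R + y * lowNeighbors G R u := by
  have hE' : ∑ w, (if G.Adj u w then (f u - f w) ^ 2 else 0) ≤ 4 * y := by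
    rw [← hE]
    exact Finset.single_le_sum (f := fun v => ∑ w, if G.Adj v w then (f v - f w) ^ 2 else 0)
      (fun v _ => Finset.sum_nonneg fun w _ => by split_ifs <;> positivity) (Finset.mem_univ u)
  -- For a neighbour `w`: if `deg w < R`, the last term pays; if `f w ≥ y/2` and `deg w ≥ R`, then
  -- `deg w · f w² ≥ R y²/4`; if `f w < y/2`, the squared increment exceeds `y²/4`.
  have hpt : ∀ w, (if G.Adj u w then y ^ 2 else 0) ≤
      4 * (if G.Adj u w then (f u - f w) ^ 2 else 0) + 4 / R * ((G.degree w : ℝ) * f w ^ 2) +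
        y ^ 2 * (if G.Adj u w then (if (G.degree w : ℝ) < R then 1 else 0) else 0) := by
    intro w
    have h0 : 0 ≤ 4 / R * ((G.degree w : ℝ) * f w ^ 2) := by positivity
    split_ifs with h1 h2
    · nlinarith [sq_nonneg (f u - f w)]
    · rw [hfu]
      rcases le_or_gt (y / 2) (f w) with h3 | h3
      · have h4 : f w ^ 2 ≤ (1 / R) * ((G.degree w : ℝ) * f w ^ 2) := by
          rw [← mul_assoc]
          refine le_mul_of_one_le_left (sq_nonneg _) ?_
          rw [one_div, inv_mul_eq_div, le_div_iff₀ hR]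
          linarith
        have h5 : 4 / R * ((G.degree w : ℝ) * f w ^ 2) =
          4 * ((1 / R) * ((G.degree w : ℝ) * f w ^ 2)) := by ring
        rw [h5]
        nlinarith [sq_nonneg (y - f w)]
      · nlinarith
    · linarith
  have hsum := Finset.sum_le_sum fun w (_ : w ∈ Finset.univ) => hpt w
  simp_rw [Finset.sum_add_distrib, ← Finset.mul_sum] at hsum
  have h1 : ∑ w, (if G.Adj u w then y ^ 2 else 0) = G.degree u * y ^ 2 := by
    rw [← sum_adj_one, Finset.sum_mul]
    exact Finset.sum_congr rfl fun w _ => by split_ifs <;> ring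
  rw [h1] at hsum
  have h2 : 4 / R * ∑ w, (G.degree w : ℝ) * f w ^ 2 ≤ 4 / R * (T * y) :=
    mul_le_mul_of_nonneg_left hN (by positivity)
  refine le_of_mul_le_mul_right ?_ hy
  calc (G.degree u : ℝ) * y * y = G.degree u * y ^ 2 := by ring
    _ ≤ 4 * (4 * y) + 4 / R * (T * y) + y ^ 2 * lowNeighbors G R u :=
        hsum.trans (by unfold lowNeighbors; linarith)
    _ = _ := by ring

/-- The dichotomy at scale `s`: a centred function with a peak either decays along a path, or
carries mass in a ball that is not the whole graph. -/
lemma degree_mul_le_of_peak [Nontrivial V] (hG : G.Connected) {f : V → ℝ} {u : V} {y T R : ℝ}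
    (s : ℕ) (hy : 0 < y) (hR : 0 < R)
    (hfu : f u = y) (hE : energy G f = 4 * y) (hN : ∑ w, (G.degree w : ℝ) * f w ^ 2 ≤ T * y)
    (hmean : ∑ w, (G.degree w : ℝ) * f w = 0) :
    (G.degree u : ℝ) * y ≤ 16 + 4 * T / R + 32 * s * lowNeighbors G R u ∨
      (∀ w, s + 1 ≤ (ball G w s).card) ∧
        (G.degree u : ℝ) * y ≤ 4 * T * ((G.degree u : ℝ) / ballVol G u (2 * s)) := by
  by_cases hb : ∀ w ∈ ball G u (2 * s), y / 2 ≤ f w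
  · right
    constructor
    -- If the ball were the whole graph, `f` would be positive everywhere, against its mean zero.
    · have hex : ∃ w, 2 * s < G.dist u w := by
        by_contra! hall
        have : 0 < ∑ w, (G.degree w : ℝ) * f w := by
          refine Finset.sum_pos (fun w _ => ?_) Finset.univ_nonempty
          have h1 := hb w (mem_ball.2 (hall w))
          exact mul_pos (degree_pos hG w) (by linarith)
        linarith
      obtain ⟨w, hw⟩ := hex
      intro z
      -- Since `u` and `w` are more than `2s` apart, every `z` is at distance at least `s` from one
      -- of them, which supplies a path long enough to fill the ball of `z`.
      have htri := hG.dist_triangle (u := u) (v := z) (w := w)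
      rw [SimpleGraph.dist_comm (u := u) (v := z)] at htri
      rcases le_or_gt s (G.dist z u) with h1 | h1
      · exact card_ball_ge hG h1
      · exact card_ball_ge (w := w) hG (by omega)
    · have hvol := ballVol_pos hG u (2 * s)
      have h1 : ballVol G u (2 * s) * (y / 2) ^ 2 ≤ T * y := by
        refine le_trans ?_ hN
        rw [ballVol, Finset.sum_mul]
        refine (Finset.sum_le_sum fun w hw => ?_).trans
          (Finset.sum_le_sum_of_subset_of_nonneg (Finset.subset_univ _) fun w _ _ => by positivity)
        exact mul_le_mul_of_nonneg_left (pow_le_pow_left₀ (by linarith) (hb w hw) 2)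
          (Nat.cast_nonneg _)
      have h2 : y ≤ 4 * T / ballVol G u (2 * s) := by
        rw [le_div_iff₀ hvol]
        refine le_of_mul_le_mul_right ?_ hy
        linarith
      calc (G.degree u : ℝ) * y ≤ G.degree u * (4 * T / ballVol G u (2 * s)) :=
            mul_le_mul_of_nonneg_left h2 (Nat.cast_nonneg _)
        _ = _ := by ring
  · left
    push Not at hb
    obtain ⟨w, hw, hlt⟩ := hb
    rw [mem_ball] at hw
    have h1 := sq_sub_le_dist_mul_energy hG f u w
    rw [hfu, hE] at h1
    have h2 : (y / 2) ^ 2 ≤ (y - f w) ^ 2 := pow_le_pow_left₀ (by positivity) (by linarith) 2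
    have hw' : (G.dist u w : ℝ) ≤ 2 * s := by exact_mod_cast hw
    have h3 : (G.dist u w : ℝ) * (4 * y) ≤ 2 * s * (4 * y) :=
      mul_le_mul_of_nonneg_right hw' (by positivity)
    -- From `y²/4 ≤ (y - f w)² ≤ 2s · 4y`.
    have h4 : y ≤ 32 * s := by
      refine le_of_mul_le_mul_right ?_ hy
      linarith
    refine (degree_mul_le_lowNeighbors hy hR hfu hE hN).trans ?_
    have := mul_le_mul_of_nonneg_right h4 (lowNeighbors_nonneg (G := G) R u)
    linarith

variable {lam : V → ℝ} {g : V → V → ℝ} {q₀ : V}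

lemma IsEigenbasis.sum_degree_mul_combination (h : IsEigenbasis G lam g) (s : Finset V)
    (a b : V → ℝ) :
    ∑ w, (G.degree w : ℝ) * ((∑ i ∈ s, a i * g i w) * ∑ j ∈ s, b j * g j w) =
      ∑ i ∈ s, a i * b i := by
  simp_rw [Finset.sum_mul_sum, Finset.mul_sum]
  rw [Finset.sum_comm]
  refine Finset.sum_congr rfl fun i hi => ?_
  rw [Finset.sum_comm]
  have : ∀ j, ∑ w, (G.degree w : ℝ) * (a i * g i w * (b j * g j w)) =
      a i * b j * if i = j then 1 else 0 := by
    intro j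
    rw [← h.orth, Finset.mul_sum]
    exact Finset.sum_congr rfl fun w _ => by ring
  simp_rw [this, mul_ite, mul_one, mul_zero]
  rw [Finset.sum_ite_eq, if_pos hi]

lemma IsEigenbasis.mulVec_combination (h : IsEigenbasis G lam g) (s : Finset V) (a : V → ℝ)
    (u : V) : (transition G).mulVec (fun w => ∑ i ∈ s, a i * g i w) u =
      ∑ i ∈ s, lam i * a i * g i u := by
  rw [transition_mulVec]
  simp_rw [Finset.mul_sum]
  rw [Finset.sum_comm]
  refine Finset.sum_congr rfl fun i _ => ?_
  rw [mul_comm (lam i), mul_assoc, ← h.eigen, transition_mulVec, Finset.mul_sum]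
  exact Finset.sum_congr rfl fun w _ => by ring

lemma IsSpectralBasis.mean_zero [Nontrivial V] (hG : G.Connected)
    (h : IsSpectralBasis G lam g q₀) {i : V} (hi : i ≠ q₀) :
    ∑ w, (G.degree w : ℝ) * g i w = 0 := by
  have h1 := h.orth i q₀
  obtain ⟨x⟩ : Nonempty V := inferInstance
  simp_rw [if_neg hi, fun w => h.const w x, ← mul_assoc, ← Finset.sum_mul] at h1
  refine (mul_eq_zero.1 h1).resolve_right fun h0 => ?_
  have h2 := h.sq x
  have := numEdges_pos hG
  rw [h0] at h2
  have h3 : 0 < 1 / (2 * (numEdges G : ℝ)) := by positivity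
  rw [← h2] at h3
  norm_num at h3

/-- The diagonal of the Green function of the walk, at the scale of the relaxation time. -/
lemma IsSpectralBasis.degree_mul_green_le [Nontrivial V] (hG : G.Connected)
    (h : IsSpectralBasis G lam g q₀) (u : V) (s : ℕ) {R : ℝ} (hR : 0 < R) :
    let y := ∑ i ∈ Finset.univ.erase q₀, (1 - lam i)⁻¹ * g i u ^ 2
    (G.degree u : ℝ) * y ≤ 16 + 4 * tRel G / R + 32 * s * lowNeighbors G R u ∨
      (∀ w, s + 1 ≤ (ball G w s).card) ∧
        (G.degree u : ℝ) * y ≤ 4 * tRel G * ((G.degree u : ℝ) / ballVol G u (2 * s)) := by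
  intro y
  set S := Finset.univ.erase q₀
  have hgap : ∀ i ∈ S, 0 < 1 - lam i := fun i hi =>
    sub_pos.2 (h.lt_one (Finset.ne_of_mem_erase hi))
  have hy0 : 0 ≤ y := Finset.sum_nonneg fun i hi =>
    mul_nonneg (inv_nonneg.2 (hgap i hi).le) (sq_nonneg _)
  rcases hy0.eq_or_lt with hy | hy
  · left
    rw [← hy, mul_zero]
    have := lowNeighbors_nonneg (G := G) R u
    positivity
  -- These coefficients make `f` the Green function at `u` with the constant mode removed. Hence `f
  -- u = y`, and applying `1 - P` to `f` leaves coefficients `g i u`, which gives the energy `4y`.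
  let a : V → ℝ := fun i => (1 - lam i)⁻¹ * g i u
  let f : V → ℝ := fun w => ∑ i ∈ S, a i * g i w
  refine degree_mul_le_of_peak (f := f) hG s hy hR ?_ ?_ ?_ ?_
  · exact Finset.sum_congr rfl fun i _ => by simp only [a]; ring
  · rw [energy_eq hG]
    have h1 : ∀ w, f w - (transition G).mulVec f w = ∑ i ∈ S, ((1 - lam i) * a i) * g i w := by
      intro w
      rw [h.mulVec_combination, ← Finset.sum_sub_distrib]
      exact Finset.sum_congr rfl fun i _ => by ring
    simp_rw [h1]
    rw [h.sum_degree_mul_combination]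
    congr 1
    refine Finset.sum_congr rfl fun i hi => ?_
    have := (hgap i hi).ne'
    simp only [a]
    field_simp
  · have h1 : ∑ w, (G.degree w : ℝ) * f w ^ 2 = ∑ i ∈ S, a i * a i := by
      refine Eq.trans ?_ (h.sum_degree_mul_combination S a a)
      exact Finset.sum_congr rfl fun w _ => by rw [pow_two]
    rw [h1, Finset.mul_sum]
    refine Finset.sum_le_sum fun i hi => ?_
    have h2 := h.inv_gap_le (Finset.ne_of_mem_erase hi)
    have h3 : 0 ≤ (1 - lam i)⁻¹ * g i u ^ 2 :=
      mul_nonneg (inv_nonneg.2 (hgap i hi).le) (sq_nonneg _)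
    calc a i * a i = (1 - lam i)⁻¹ * ((1 - lam i)⁻¹ * g i u ^ 2) := by simp only [a]; ring
      _ ≤ _ := mul_le_mul_of_nonneg_right h2 h3
  · simp_rw [f, Finset.mul_sum]
    rw [Finset.sum_comm]
    refine Finset.sum_eq_zero fun i hi => ?_
    have h1 := h.mean_zero hG (Finset.ne_of_mem_erase hi)
    calc ∑ w, (G.degree w : ℝ) * (a i * g i w) = a i * ∑ w, (G.degree w : ℝ) * g i w := by
          rw [Finset.mul_sum]
          exact Finset.sum_congr rfl fun w _ => by ring
      _ = 0 := by rw [h1, mul_zero]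

/-- A trace identity: integrating the diagonal of the Green function against the degrees makes each
normalized eigenfunction count once. -/
lemma IsSpectralBasis.sum_degree_mul_green (h : IsSpectralBasis G lam g q₀) :
    ∑ u, (G.degree u : ℝ) * ∑ i ∈ Finset.univ.erase q₀, (1 - lam i)⁻¹ * g i u ^ 2 =
      ∑ i ∈ Finset.univ.erase q₀, (1 - lam i)⁻¹ := by
  simp_rw [Finset.mul_sum]
  rw [Finset.sum_comm]
  refine Finset.sum_congr rfl fun i _ => ?_
  have h1 := h.orth i i
  rw [if_pos rfl] at h1
  nth_rw 2 [← mul_one (1 - lam i)⁻¹]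
  rw [← h1, Finset.mul_sum]
  exact Finset.sum_congr rfl fun u _ => by ring

/-- The sum of the inverse spectral gaps is `O(n t_rel^{2/3})`. -/
theorem IsSpectralBasis.sum_inv_gap_le [Nontrivial V] (hG : G.Connected)
    (h : IsSpectralBasis G lam g q₀) :
    ∑ i ∈ Finset.univ.erase q₀, (1 - lam i)⁻¹ ≤
      88 * (Fintype.card V * (tRel G : ℝ) ^ (2 / 3 : ℝ)) := by
  have hT := one_le_tRel hG
  set T : ℝ := (tRel G : ℝ)
  set R : ℝ := T ^ (1 / 3 : ℝ)
  have hR1 : 1 ≤ R := Real.one_le_rpow hT (by norm_num)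
  have hR0 : 0 < R := by linarith
  have hR2 : T ^ (2 / 3 : ℝ) = R ^ 2 := by
    rw [← Real.rpow_natCast, ← Real.rpow_mul (by linarith)]
    norm_num
  have hR3 : T = R ^ 3 := by
    rw [← Real.rpow_natCast, ← Real.rpow_mul (by linarith)]
    norm_num
  have hn : (0 : ℝ) < Fintype.card V := by exact_mod_cast Fintype.card_pos
  set n : ℝ := (Fintype.card V : ℝ)
  -- With `s ≈ R = T^{1/3}`, the three costs `T/R`, `sR` and `T/s` all have order `R² = T^{2/3}`.
  -- The constant is `88 = 16 + 4 + 64 + 4`.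
  set s : ℕ := ⌈R⌉₊
  have hs1 : R ≤ s := Nat.le_ceil R
  have hs2 : (s : ℝ) ≤ 2 * R := by
    have := (Nat.ceil_lt_add_one hR0.le).le
    linarith
  have hTR : 4 * T / R = 4 * R ^ 2 := by
    rw [hR3]
    field_simp
  rw [hR2, ← h.sum_degree_mul_green]
  have hlow := sum_lowNeighbors_le (G := G) hR0.le
  have hmain : ∑ u, (16 + 4 * T / R + 32 * s * lowNeighbors G R u) ≤ 84 * (n * R ^ 2) := by
    simp_rw [Finset.sum_add_distrib, ← Finset.mul_sum, Finset.sum_const, Finset.card_univ,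
      nsmul_eq_mul, hTR]
    have h1 : 32 * (s : ℝ) * ∑ u, lowNeighbors G R u ≤ 32 * (2 * R) * (n * R) :=
      mul_le_mul (by linarith) hlow (Finset.sum_nonneg fun u _ => lowNeighbors_nonneg R u)
        (by positivity)
    have h2 : n * 1 ≤ n * R ^ 2 := mul_le_mul_of_nonneg_left (one_le_pow₀ hR1) hn.le
    nlinarith
  by_cases hw : ∀ w, s + 1 ≤ (ball G w s).card
  · have hball := sum_degree_div_ballVol_le hG hw
    have h1 : 4 * T * ∑ u, (G.degree u : ℝ) / ballVol G u (2 * s) ≤ 4 * (n * R ^ 2) := by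
      calc 4 * T * ∑ u, (G.degree u : ℝ) / ballVol G u (2 * s) ≤ 4 * T * (n / (s + 1)) :=
            mul_le_mul_of_nonneg_left hball (by linarith)
        _ ≤ 4 * T * (n / R) := by
            refine mul_le_mul_of_nonneg_left ?_ (by linarith)
            exact div_le_div_of_nonneg_left hn.le hR0 (by linarith)
        _ = (4 * T / R) * n := by ring
        _ = _ := by rw [hTR]; ring
    have h2 : ∑ u, (G.degree u : ℝ) * ∑ i ∈ Finset.univ.erase q₀, (1 - lam i)⁻¹ * g i u ^ 2 ≤
        ∑ u, ((16 + 4 * T / R + 32 * s * lowNeighbors G R u) +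
          4 * T * ((G.degree u : ℝ) / ballVol G u (2 * s))) := by
      refine Finset.sum_le_sum fun u _ => ?_
      have h3 := lowNeighbors_nonneg (G := G) R u
      have h4 := (ballVol_pos hG u (2 * s)).le
      have h5 : 0 ≤ 16 + 4 * T / R + 32 * s * lowNeighbors G R u := by positivity
      have h6 : 0 ≤ 4 * T * ((G.degree u : ℝ) / ballVol G u (2 * s)) := by positivity
      rcases h.degree_mul_green_le hG u s hR0 with h7 | ⟨-, h7⟩
      · exact h7.trans (by linarith)
      · exact h7.trans (by linarith)
    rw [Finset.sum_add_distrib, ← Finset.mul_sum] at h2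
    linarith
  · have h2 : ∑ u, (G.degree u : ℝ) * ∑ i ∈ Finset.univ.erase q₀, (1 - lam i)⁻¹ * g i u ^ 2 ≤
        ∑ u, (16 + 4 * T / R + 32 * s * lowNeighbors G R u) :=
      Finset.sum_le_sum fun u _ =>
        (h.degree_mul_green_le hG u s hR0).resolve_right fun h7 => hw h7.1
    have : 0 ≤ n * R ^ 2 := by positivity
    linarith

theorem IsSpectralBasis.sum_inv_gap_sq_le [Nontrivial V] (hG : G.Connected)
    (h : IsSpectralBasis G lam g q₀) :
    ∑ i ∈ Finset.univ.erase q₀, ((1 - lam i)⁻¹) ^ 2 ≤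
      88 * (Fintype.card V * (tRel G : ℝ) ^ (5 / 3 : ℝ)) := by
  have hT := one_le_tRel hG
  have h1 : (tRel G : ℝ) ^ (5 / 3 : ℝ) = tRel G * (tRel G : ℝ) ^ (2 / 3 : ℝ) := by
    nth_rw 2 [← Real.rpow_one (tRel G : ℝ)]
    rw [← Real.rpow_add (by linarith)]
    norm_num
  calc ∑ i ∈ Finset.univ.erase q₀, ((1 - lam i)⁻¹) ^ 2
      ≤ ∑ i ∈ Finset.univ.erase q₀, (tRel G : ℝ) * (1 - lam i)⁻¹ := by
        refine Finset.sum_le_sum fun i hi => ?_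
        have hne := Finset.ne_of_mem_erase hi
        rw [pow_two]
        exact mul_le_mul_of_nonneg_right (h.inv_gap_le hne)
          (inv_nonneg.2 (sub_pos.2 (h.lt_one hne)).le)
    _ = tRel G * ∑ i ∈ Finset.univ.erase q₀, (1 - lam i)⁻¹ := by rw [Finset.mul_sum]
    _ ≤ tRel G * (88 * (Fintype.card V * (tRel G : ℝ) ^ (2 / 3 : ℝ))) :=
        mul_le_mul_of_nonneg_left (h.sum_inv_gap_le hG) (by linarith)
    _ = _ := by rw [h1]; ring

end Green

/-! ### First and second moments of the intersection count. -/

section Moments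

set_option linter.unusedSectionVars false

variable {V : Type*} [Fintype V] [DecidableEq V] {G : SimpleGraph V} [DecidableRel G.Adj]
  [MeasurableSpace V] [MeasurableSingletonClass V] {x : V} {Ω : Type*} [MeasurableSpace Ω]
  {μ : Measure Ω} [IsProbabilityMeasure μ] {X Y : ℕ → Ω → V}

lemma IsLazyWalk.measurable_process (hX : IsLazyWalk G x μ X) :
    Measurable fun ω i => X i ω := measurable_pi_lambda _ hX.measurable

lemma IsLazyWalk.measurableSet_eq (hX : IsLazyWalk G x μ X) (i : ℕ) (u : V) :
    MeasurableSet {ω | X i ω = u} := hX.measurable i (measurableSet_singleton u)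

/-- Extension of a finite path by a constant. -/
def extendPath {k : ℕ} (z : Fin (k + 1) → V) (w : V) (i : ℕ) : V :=
  if h : i < k + 1 then z ⟨i, h⟩ else w

/-- `IsLazyWalk` only specifies probabilities of full initial paths, so events at single times are
split over all paths up to time `k`. The padding value `w` serves as the position at time `k + 1` in
`IsLazyWalk.step`. -/
lemma IsLazyWalk.sum_paths (hX : IsLazyWalk G x μ X) {i k : ℕ} (hik : i ≤ k) (u w : V)
    (A : Set Ω) :
    μ.real ({ω | X i ω = u} ∩ A) = ∑ z : Fin (k + 1) → V,
      if z ⟨i, Nat.lt_succ_of_le hik⟩ = u then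
        μ.real ({ω | ∀ j ≤ k, X j ω = extendPath z w j} ∩ A) else 0 := by
  let Z : Ω → Fin (k + 1) → V := fun ω j => X j ω
  have hZ : ∀ z, Z ⁻¹' {z} = {ω | ∀ j ≤ k, X j ω = extendPath z w j} := by
    intro z
    ext ω
    simp only [Set.mem_preimage, Set.mem_singleton_iff, Set.mem_ofPred_eq, funext_iff, Z]
    constructor
    · intro h j hj
      rw [extendPath, dif_pos (Nat.lt_succ_of_le hj)]
      exact h ⟨j, Nat.lt_succ_of_le hj⟩
    · intro h j
      rw [h j (Nat.le_of_lt_succ j.2), extendPath, dif_pos j.2]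
  have hZm : Measurable Z := measurable_pi_lambda _ fun j => hX.measurable j
  have hmeas : ∀ z, MeasurableSet (Z ⁻¹' {z}) := fun z => hZm (measurableSet_singleton z)
  have h := sum_measureReal_preimage_singleton (μ := μ.restrict A)
    (Finset.univ.filter fun z : Fin (k + 1) → V => z ⟨i, Nat.lt_succ_of_le hik⟩ = u) (f := Z)
    (fun z _ => hmeas z)
  rw [Finset.sum_filter] at h
  have hset : Z ⁻¹' ↑(Finset.univ.filter fun z : Fin (k + 1) → V =>
      z ⟨i, Nat.lt_succ_of_le hik⟩ = u) = {ω | X i ω = u} := by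
    ext ω
    simp [Z]
  rw [hset, measureReal_restrict_apply (hX.measurableSet_eq i u)] at h
  rw [← h]
  refine Finset.sum_congr rfl fun z _ => ?_
  rw [measureReal_restrict_apply (hmeas z), hZ]

/-- The Markov property at time `k`: each path probability gains one transition factor when extended
to `w`. -/
lemma IsLazyWalk.step (hX : IsLazyWalk G x μ X) {i k : ℕ} (hik : i ≤ k) (u w : V) :
    μ.real {ω | X i ω = u ∧ X (k + 1) ω = w} =
      ∑ v, μ.real {ω | X i ω = u ∧ X k ω = v} * transition G v w := by
  have h1 := hX.sum_paths hik u w {ω | X (k + 1) ω = w}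
  have h2 := fun v => hX.sum_paths hik u w {ω | X k ω = v}
  simp only [← Set.ofPred_and] at h1 h2
  rw [h1]
  simp_rw [h2, Finset.sum_mul]
  rw [Finset.sum_comm]
  refine Finset.sum_congr rfl fun z _ => ?_
  split_ifs with hz
  · have hk : extendPath z w k = z (Fin.last k) := by
      rw [extendPath, dif_pos (Nat.lt_succ_self k)]
      rfl
    have h3 : {ω | (∀ j ≤ k, X j ω = extendPath z w j) ∧ X (k + 1) ω = w} =
        {ω | ∀ j ≤ k + 1, X j ω = extendPath z w j} := by
      ext ω
      simp only [Set.mem_ofPred_eq]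
      constructor
      · rintro ⟨ha, hb⟩ j hj
        rcases Nat.le_succ_iff.1 hj with h | h
        · exact ha j h
        · rw [h, extendPath, dif_neg (by omega)]
          exact hb
      · intro ha
        refine ⟨fun j hj => ha j (by omega), ?_⟩
        have := ha (k + 1) le_rfl
        rwa [extendPath, dif_neg (by omega)] at this
    have h4 : ∀ v, μ.real {ω | (∀ j ≤ k, X j ω = extendPath z w j) ∧ X k ω = v} =
        if v = z (Fin.last k) then μ.real {ω | ∀ j ≤ k, X j ω = extendPath z w j} else 0 := by
      intro v
      split_ifs with hv
      · congr 1
        ext ω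
        simp only [Set.mem_ofPred_eq, and_iff_left_iff_imp]
        intro ha
        rw [ha k le_rfl, hk, hv]
      · have : {ω | (∀ j ≤ k, X j ω = extendPath z w j) ∧ X k ω = v} = ∅ := by
          ext ω
          simp only [Set.mem_ofPred_eq, Set.mem_empty_iff_false, iff_false, not_and]
          intro ha hb
          rw [ha k le_rfl, hk] at hb
          exact hv hb.symm
        rw [this, measureReal_empty]
    simp_rw [h4, ite_mul, zero_mul]
    rw [Finset.sum_ite_eq' , if_pos (Finset.mem_univ _), h3, hX.law, hX.law, Finset.prod_range_succ]
    have hk1 : extendPath z w (k + 1) = w := by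
      rw [extendPath, dif_neg (by omega)]
    rw [hk, hk1]
    split_ifs <;> simp
  · simp

lemma IsLazyWalk.two_point_of_le (hX : IsLazyWalk G x μ X) {i k : ℕ} (hik : i ≤ k) (u w : V) :
    μ.real {ω | X i ω = u ∧ X k ω = w} =
      μ.real {ω | X i ω = u} * (transition G ^ (k - i)) u w := by
  induction k, hik using Nat.le_induction generalizing w with
  | base =>
    rw [Nat.sub_self, pow_zero, Matrix.one_apply]
    split_ifs with h
    · simp [h]
    · have : {ω | X i ω = u ∧ X i ω = w} = ∅ := by
        ext ω
        simp only [Set.mem_ofPred_eq, Set.mem_empty_iff_false, iff_false, not_and]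
        intro ha hb
        exact h (ha.symm.trans hb)
      rw [this, measureReal_empty, mul_zero]
  | succ k hik ih =>
    rw [hX.step hik, Nat.succ_sub hik, pow_succ, Matrix.mul_apply, Finset.mul_sum]
    simp_rw [ih, mul_assoc]

lemma IsLazyWalk.marginal (hX : IsLazyWalk G x μ X) (k : ℕ) (w : V) :
    μ.real {ω | X k ω = w} = (transition G ^ k) x w := by
  have h0 : ∀ u, μ.real {ω | X 0 ω = u} = if u = x then 1 else 0 := by
    intro u
    have := hX.law 0 fun _ => u
    simpa using this
  have h1 := sum_measureReal_preimage_singleton (μ := μ.restrict {ω | X k ω = w})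
    (Finset.univ : Finset V) (f := X 0) (fun u _ => hX.measurableSet_eq 0 u)
  have h2 : ∀ u, (μ.restrict {ω | X k ω = w}).real (X 0 ⁻¹' {u}) =
      μ.real {ω | X 0 ω = u ∧ X k ω = w} := by
    intro u
    exact measureReal_restrict_apply (hX.measurableSet_eq 0 u)
  simp_rw [h2, hX.two_point_of_le (Nat.zero_le k), h0] at h1
  simpa using h1.symm

/-- A uniform bound on the two-point probabilities after the uniform mixing time. -/
lemma IsLazyWalk.two_point_le [Nontrivial V] (hG : G.Connected) (hX : IsLazyWalk G x μ X)
    {i k : ℕ} (hi : tUnif G ≤ i) (hk : tUnif G ≤ k) (u w : V) :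
    μ.real {ω | X i ω = u ∧ X k ω = w} ≤
      5 / 4 * (stationary G u * (transition G ^ (i.dist k)) u w) := by
  rcases le_total i k with h | h
  · rw [hX.two_point_of_le h, hX.marginal, Nat.dist_eq_sub_of_le h, ← mul_assoc]
    exact mul_le_mul_of_nonneg_right (pow_le_of_tUnif_le hG hi x u) (transition_pow_nonneg _ _ _)
  · have : {ω | X i ω = u ∧ X k ω = w} = {ω | X k ω = w ∧ X i ω = u} := by
      ext ω
      exact and_comm
    rw [this, hX.two_point_of_le h, hX.marginal, Nat.dist_eq_sub_of_le_right h,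
      stationary_mul_pow_symm hG, ← mul_assoc]
    exact mul_le_mul_of_nonneg_right (pow_le_of_tUnif_le hG hk x w) (transition_pow_nonneg _ _ _)

/-- The indicator that a path is at `u` at time `i` and at `w` at time `k`. -/
def visits (i k : ℕ) (u w : V) (a : ℕ → V) : ℝ := if a i = u ∧ a k = w then 1 else 0

lemma measurable_visits (i k : ℕ) (u w : V) : Measurable (visits i k u w) := by
  have h : ∀ (j : ℕ) (v : V), MeasurableSet {a : ℕ → V | a j = v} := fun j v =>
    measurable_pi_apply (X := fun _ : ℕ => V) j (measurableSet_singleton v)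
  exact Measurable.ite ((h i u).inter (h k w)) measurable_const measurable_const

lemma abs_visits_le (i k : ℕ) (u w : V) (a : ℕ → V) : |visits i k u w a| ≤ 1 := by
  unfold visits
  split_ifs <;> simp

lemma IsLazyWalk.integral_visits (hX : IsLazyWalk G x μ X) (i k : ℕ) (u w : V) :
    ∫ ω, visits i k u w (fun n => X n ω) ∂μ = μ.real {ω | X i ω = u ∧ X k ω = w} := by
  have hm : MeasurableSet {ω | X i ω = u ∧ X k ω = w} :=
    (hX.measurableSet_eq i u).inter (hX.measurableSet_eq k w)
  rw [← integral_indicator_one hm]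
  refine integral_congr_ae (Filter.Eventually.of_forall fun ω => ?_)
  simp [visits, Set.indicator_apply]

lemma integral_visits_mul_visits (hX : IsLazyWalk G x μ X) (hY : IsLazyWalk G x μ Y)
    (hXY : IndepFun (fun ω i => X i ω) (fun ω i => Y i ω) μ) (i k j l : ℕ) (u w : V) :
    ∫ ω, visits i k u w (fun n => X n ω) * visits j l u w (fun n => Y n ω) ∂μ =
      μ.real {ω | X i ω = u ∧ X k ω = w} * μ.real {ω | Y j ω = u ∧ Y l ω = w} := by
  rw [← hX.integral_visits, ← hY.integral_visits]
  have h := hXY.comp (measurable_visits i k u w) (measurable_visits j l u w)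
  exact h.integral_fun_mul_eq_mul_integral
    ((measurable_visits i k u w).comp hX.measurable_process).aestronglyMeasurable
    ((measurable_visits j l u w).comp hY.measurable_process).aestronglyMeasurable

lemma integrable_visits_mul_visits (hX : IsLazyWalk G x μ X) (hY : IsLazyWalk G x μ Y)
    (i k j l : ℕ) (u w : V) (c : ℝ) :
    Integrable (fun ω => visits i k u w (fun n => X n ω) * visits j l u w (fun n => Y n ω) * c)
      μ := by
  refine Integrable.mul_const (Integrable.of_bound (C := 1) ?_ (Filter.Eventually.of_forall ?_)) _
  · exact (((measurable_visits i k u w).comp hX.measurable_process).mul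
      ((measurable_visits j l u w).comp hY.measurable_process)).aestronglyMeasurable
  · intro ω
    rw [norm_mul]
    exact mul_le_one₀ (abs_visits_le _ _ _ _ _) (norm_nonneg _) (abs_visits_le _ _ _ _ _)

/-- Splitting a meeting by its location separates the two walks, so that independence factorizes
expectations. -/
lemma weightedIntersections_eq (s t : ℕ) (a b : ℕ → V) :
    weightedIntersections G s t a b = ∑ p ∈ Finset.Ico s (s + t) ×ˢ Finset.Ico s (s + t),
      ∑ u, visits p.1 p.1 u u a * visits p.2 p.2 u u b * (1 / (G.degree u : ℝ)) := by
  rw [Finset.sum_product]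
  unfold weightedIntersections
  refine Finset.sum_congr rfl fun i _ => Finset.sum_congr rfl fun j _ => ?_
  rw [Finset.sum_eq_single (a i)]
  · simp [visits, eq_comm]
  · intro u _ hu
    simp [visits, hu.symm]
  · simp

lemma weightedIntersections_sq (s t : ℕ) (a b : ℕ → V) :
    weightedIntersections G s t a b ^ 2 =
      ∑ p ∈ Finset.Ico s (s + t) ×ˢ Finset.Ico s (s + t),
        ∑ q ∈ Finset.Ico s (s + t) ×ˢ Finset.Ico s (s + t), ∑ u, ∑ w,
          visits p.1 q.1 u w a * visits p.2 q.2 u w b *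
            (1 / (G.degree u : ℝ) * (1 / (G.degree w : ℝ))) := by
  rw [weightedIntersections_eq, pow_two, Finset.sum_mul_sum]
  refine Finset.sum_congr rfl fun p _ => Finset.sum_congr rfl fun q _ => ?_
  rw [Finset.sum_mul_sum]
  refine Finset.sum_congr rfl fun u _ => Finset.sum_congr rfl fun w _ => ?_
  have h1 : ∀ (i k : ℕ) (c : ℕ → V), visits i k u w c = visits i i u u c * visits k k w w c := by
    intro i k c
    unfold visits
    by_cases h1 : c i = u <;> by_cases h2 : c k = w <;> simp [h1, h2]
  rw [h1, h1 p.2]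
  ring

lemma IsLazyWalk.integral_weightedIntersections (hX : IsLazyWalk G x μ X)
    (hY : IsLazyWalk G x μ Y) (hXY : IndepFun (fun ω i => X i ω) (fun ω i => Y i ω) μ)
    (s t : ℕ) :
    ∫ ω, weightedIntersections G s t (fun i => X i ω) (fun i => Y i ω) ∂μ =
      ∑ p ∈ Finset.Ico s (s + t) ×ˢ Finset.Ico s (s + t), ∑ u,
        (transition G ^ p.1) x u * (transition G ^ p.2) x u * (1 / (G.degree u : ℝ)) := by
  simp_rw [weightedIntersections_eq]
  rw [integral_finsetSum _ fun p _ => integrable_finsetSum _ fun u _ =>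
    integrable_visits_mul_visits hX hY _ _ _ _ _ _ _]
  refine Finset.sum_congr rfl fun p _ => ?_
  rw [integral_finsetSum _ fun u _ => integrable_visits_mul_visits hX hY _ _ _ _ _ _ _]
  refine Finset.sum_congr rfl fun u _ => ?_
  rw [integral_mul_const, integral_visits_mul_visits hX hY hXY]
  simp only [and_self, hX.marginal, hY.marginal]

lemma IsLazyWalk.integral_weightedIntersections_sq (hX : IsLazyWalk G x μ X)
    (hY : IsLazyWalk G x μ Y) (hXY : IndepFun (fun ω i => X i ω) (fun ω i => Y i ω) μ)
    (s t : ℕ) :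
    ∫ ω, weightedIntersections G s t (fun i => X i ω) (fun i => Y i ω) ^ 2 ∂μ =
      ∑ p ∈ Finset.Ico s (s + t) ×ˢ Finset.Ico s (s + t),
        ∑ q ∈ Finset.Ico s (s + t) ×ˢ Finset.Ico s (s + t), ∑ u, ∑ w,
          μ.real {ω | X p.1 ω = u ∧ X q.1 ω = w} * μ.real {ω | Y p.2 ω = u ∧ Y q.2 ω = w} *
            (1 / (G.degree u : ℝ) * (1 / (G.degree w : ℝ))) := by
  have hint := fun i k j l u w c => integrable_visits_mul_visits hX hY i k j l u w c
  simp_rw [weightedIntersections_sq]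
  rw [integral_finsetSum _ fun p _ => integrable_finsetSum _ fun q _ =>
    integrable_finsetSum _ fun u _ => integrable_finsetSum _ fun w _ => hint _ _ _ _ _ _ _]
  refine Finset.sum_congr rfl fun p _ => ?_
  rw [integral_finsetSum _ fun q _ => integrable_finsetSum _ fun u _ =>
    integrable_finsetSum _ fun w _ => hint _ _ _ _ _ _ _]
  refine Finset.sum_congr rfl fun q _ => ?_
  rw [integral_finsetSum _ fun u _ => integrable_finsetSum _ fun w _ => hint _ _ _ _ _ _ _]
  refine Finset.sum_congr rfl fun u _ => ?_
  rw [integral_finsetSum _ fun w _ => hint _ _ _ _ _ _ _]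
  refine Finset.sum_congr rfl fun w _ => ?_
  rw [integral_mul_const, integral_visits_mul_visits hX hY hXY]

/-- After the uniform mixing time, the probability that two independent walks meet, weighted by
the inverse degree, is within a factor `1 ± 1/16` of `1 / 2m`. -/
lemma abs_sum_pow_mul_pow_sub_le [Nontrivial V] (hG : G.Connected) {i j : ℕ} (hi : tUnif G ≤ i)
    (hj : tUnif G ≤ j) (x : V) :
    |∑ u, (transition G ^ i) x u * (transition G ^ j) x u * (1 / (G.degree u : ℝ)) -
      1 / (2 * numEdges G)| ≤ 1 / 16 * (1 / (2 * numEdges G)) := by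
  have hm := numEdges_pos hG
  -- Mean zero of the relative errors removes the two linear terms below; only their product, at
  -- most `1/4 · 1/4`, survives.
  have hmean : ∀ k, ∑ u, stationary G u * ((transition G ^ k) x u / stationary G u - 1) = 0 := by
    intro k
    have : ∀ u, stationary G u * ((transition G ^ k) x u / stationary G u - 1) =
        (transition G ^ k) x u - stationary G u := by
      intro u
      have := (stationary_pos hG u).ne'
      field_simp
    simp_rw [this, Finset.sum_sub_distrib, pow_sum hG, stationary_sum hG, sub_self]
  set ε : ℕ → V → ℝ := fun k u => (transition G ^ k) x u / stationary G u - 1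
  have h1 : ∑ u, (transition G ^ i) x u * (transition G ^ j) x u * (1 / (G.degree u : ℝ)) =
      1 / (2 * numEdges G) * ∑ u, (stationary G u + stationary G u * ε i u +
        stationary G u * ε j u + stationary G u * (ε i u * ε j u)) := by
    rw [Finset.mul_sum]
    refine Finset.sum_congr rfl fun u _ => ?_
    have hπ := (stationary_pos hG u).ne'
    have hd := (degree_pos hG u).ne'
    have h2 : ∀ k, (transition G ^ k) x u = stationary G u * (1 + ε k u) := by
      intro k
      simp only [ε]
      field_simp
      ring
    rw [h2, h2]
    have h3 : stationary G u * (1 / (G.degree u : ℝ)) = 1 / (2 * numEdges G) := by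
      unfold stationary
      field_simp
    rw [← h3]
    ring
  have h4 : ∑ u, (stationary G u + stationary G u * ε i u +
        stationary G u * ε j u + stationary G u * (ε i u * ε j u)) =
      1 + ∑ u, stationary G u * (ε i u * ε j u) := by
    simp_rw [Finset.sum_add_distrib, stationary_sum hG]
    rw [hmean, hmean]
    ring
  have h5 : |∑ u, stationary G u * (ε i u * ε j u)| ≤ 1 / 16 := by
    calc |∑ u, stationary G u * (ε i u * ε j u)|
        ≤ ∑ u, |stationary G u * (ε i u * ε j u)| := Finset.abs_sum_le_sum_abs _ _
      _ ≤ ∑ u, stationary G u * (1 / 4 * (1 / 4)) := by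
          refine Finset.sum_le_sum fun u _ => ?_
          rw [abs_mul, abs_mul, abs_of_pos (stationary_pos hG u)]
          exact mul_le_mul_of_nonneg_left (mul_le_mul (mixing_of_tUnif_le hG hi x u)
            (mixing_of_tUnif_le hG hj x u) (abs_nonneg _) (by norm_num)) (stationary_pos hG u).le
      _ = 1 / 16 := by rw [← Finset.sum_mul, stationary_sum hG]; norm_num
  rw [h1, h4, mul_add, mul_one, add_sub_cancel_left, abs_mul, abs_of_pos (by positivity), mul_comm]
  exact mul_le_mul_of_nonneg_right h5 (by positivity)

theorem abs_integral_interJ_sub_le [Nontrivial V] (hG : G.Connected) (hX : IsLazyWalk G x μ X)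
    (hY : IsLazyWalk G x μ Y) (hXY : IndepFun (fun ω i => X i ω) (fun ω i => Y i ω) μ) (t : ℕ) :
    |∫ ω, interJ G t (fun i => X i ω) (fun i => Y i ω) ∂μ - (t : ℝ) ^ 2 / (2 * numEdges G)| ≤
      1 / 16 * ((t : ℝ) ^ 2 / (2 * numEdges G)) := by
  unfold interJ
  rw [hX.integral_weightedIntersections hY hXY]
  set I := Finset.Ico (tUnif G) (tUnif G + t)
  have hcard : ((I ×ˢ I).card : ℝ) = (t : ℝ) ^ 2 := by
    simp [I, pow_two]
  have h1 : (t : ℝ) ^ 2 / (2 * numEdges G) = ∑ p ∈ I ×ˢ I, 1 / (2 * (numEdges G : ℝ)) := by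
    rw [Finset.sum_const, nsmul_eq_mul, hcard]
    ring
  rw [h1, ← Finset.sum_sub_distrib, Finset.mul_sum]
  refine (Finset.abs_sum_le_sum_abs _ _).trans (Finset.sum_le_sum fun p hp => ?_)
  rw [Finset.mem_product, Finset.mem_Ico, Finset.mem_Ico] at hp
  exact abs_sum_pow_mul_pow_sub_le hG hp.1.1 hp.2.1 x

/-- For fixed `i`, each distance `a < t` is attained by at most two times, `i + a` and `i - a`. -/
lemma sum_pow_dist_le (s t : ℕ) {r : ℝ} (hr : 0 ≤ r) :
    ∑ i ∈ Finset.Ico s (s + t), ∑ k ∈ Finset.Ico s (s + t), r ^ (i.dist k) ≤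
      2 * t * ∑ a ∈ Finset.range t, r ^ a := by
  have h : ∀ i ∈ Finset.Ico s (s + t), ∑ k ∈ Finset.Ico s (s + t), r ^ (i.dist k) ≤
      2 * ∑ a ∈ Finset.range t, r ^ a := by
    intro i hi
    rw [← Finset.sum_fiberwise_of_maps_to (s := Finset.Ico s (s + t)) (t := Finset.range t)
      (g := fun k => i.dist k), Finset.mul_sum]
    · refine Finset.sum_le_sum fun a _ => ?_
      have h1 : ∑ k ∈ Finset.Ico s (s + t) with i.dist k = a, r ^ (i.dist k) =
          ((Finset.Ico s (s + t)).filter fun k => i.dist k = a).card * r ^ a := by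
        rw [← nsmul_eq_mul, ← Finset.sum_const]
        refine Finset.sum_congr rfl fun k hk => ?_
        rw [(Finset.mem_filter.1 hk).2]
      rw [h1]
      refine mul_le_mul_of_nonneg_right ?_ (pow_nonneg hr a)
      have h2 : (Finset.Ico s (s + t)).filter (fun k => i.dist k = a) ⊆ {i + a, i - a} := by
        intro k hk
        have := (Finset.mem_filter.1 hk).2
        simp only [Finset.mem_insert, Finset.mem_singleton]
        unfold Nat.dist at this
        omega
      exact_mod_cast (Finset.card_le_card h2).trans Finset.card_le_two
    · intro k hk
      rw [Finset.mem_Ico] at hi hk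
      rw [Finset.mem_range]
      unfold Nat.dist
      omega
  refine (Finset.sum_le_sum h).trans ?_
  simp only [Finset.sum_const, Nat.card_Ico, nsmul_eq_mul]
  rw [Nat.add_sub_cancel_left]
  exact le_of_eq (by ring)

lemma sum_range_pow_le_inv {r : ℝ} (h0 : 0 ≤ r) (h1 : r < 1) (t : ℕ) :
    ∑ a ∈ Finset.range t, r ^ a ≤ (1 - r)⁻¹ := by
  rw [← tsum_geometric_of_lt_one h0 h1]
  exact (summable_geometric_of_lt_one h0 h1).sum_le_tsum _ fun a _ => pow_nonneg h0 a

theorem integral_interJ_sq_le [Nontrivial V] (hG : G.Connected) (hX : IsLazyWalk G x μ X)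
    (hY : IsLazyWalk G x μ Y) (hXY : IndepFun (fun ω i => X i ω) (fun ω i => Y i ω) μ) (t : ℕ) :
    ∫ ω, interJ G t (fun i => X i ω) (fun i => Y i ω) ^ 2 ∂μ ≤
      138 * ((t : ℝ) ^ 2 / (numEdges G : ℝ) ^ 2 *
        ((t : ℝ) ^ 2 + Fintype.card V * (tRel G : ℝ) ^ (5 / 3 : ℝ))) := by
  have hm := numEdges_pos hG
  obtain ⟨lam, g, q₀, h⟩ := exists_spectralBasis hG
  unfold interJ
  rw [hX.integral_weightedIntersections_sq hY hXY]
  set I := Finset.Ico (tUnif G) (tUnif G + t)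
  set c : ℝ := 25 / (64 * (numEdges G : ℝ) ^ 2)
  have hc : 0 ≤ c := by positivity
  have hterm : ∀ p ∈ I ×ˢ I, ∀ q ∈ I ×ˢ I, ∑ u, ∑ w,
      μ.real {ω | X p.1 ω = u ∧ X q.1 ω = w} * μ.real {ω | Y p.2 ω = u ∧ Y q.2 ω = w} *
        (1 / (G.degree u : ℝ) * (1 / (G.degree w : ℝ))) ≤
      c * ∑ z, lam z ^ (p.1.dist q.1) * lam z ^ (p.2.dist q.2) := by
    intro p hp q hq
    simp only [I, Finset.mem_product, Finset.mem_Ico] at hp hq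
    simp_rw [← pow_add]
    rw [← h.trace_pow, pow_add, Matrix.trace, Finset.mul_sum]
    refine Finset.sum_le_sum fun u _ => ?_
    rw [Matrix.diag_apply, Matrix.mul_apply, Finset.mul_sum]
    refine Finset.sum_le_sum fun w _ => ?_
    have hu := degree_pos hG u
    have hw := degree_pos hG w
    have h1 := hX.two_point_le hG hp.1.1 hq.1.1 u w
    have h2 := hY.two_point_le hG hp.2.1 hq.2.1 u w
    -- Reversing the second walk produces `P^a(u,w) P^b(w,u)`, whose sum over `u` and `w` is the
    -- trace of `P^(a+b)`. The remaining weights `π(u) π(w) / (deg u deg w)` equal `1/4m²`, so `c =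
    -- (5/4)²/4m²`.
    rw [stationary_mul_pow_symm hG _ u w] at h2
    have h3 := mul_le_mul h1 h2 measureReal_nonneg (mul_nonneg (by norm_num)
      (mul_nonneg (stationary_pos hG u).le (transition_pow_nonneg _ _ _)))
    refine (mul_le_mul_of_nonneg_right h3 (by positivity)).trans (le_of_eq ?_)
    simp only [c, stationary]
    field_simp
    ring
  refine (Finset.sum_le_sum fun p hp => Finset.sum_le_sum fun q hq => hterm p hp q hq).trans ?_
  -- For each eigenvalue the times of the two walks separate, so the fourfold sum is a square.
  have hswap : ∑ p ∈ I ×ˢ I, ∑ q ∈ I ×ˢ I,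
      c * ∑ z, lam z ^ (p.1.dist q.1) * lam z ^ (p.2.dist q.2) =
      c * ∑ z, (∑ i ∈ I, ∑ k ∈ I, lam z ^ (i.dist k)) ^ 2 := by
    simp_rw [← Finset.mul_sum]
    congr 1
    calc ∑ p ∈ I ×ˢ I, ∑ q ∈ I ×ˢ I, ∑ z, lam z ^ (p.1.dist q.1) * lam z ^ (p.2.dist q.2)
        = ∑ z, ∑ p ∈ I ×ˢ I, ∑ q ∈ I ×ˢ I, lam z ^ (p.1.dist q.1) * lam z ^ (p.2.dist q.2) :=
          (Finset.sum_congr rfl fun p _ => Finset.sum_comm).trans Finset.sum_comm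
      _ = _ := by
          refine Finset.sum_congr rfl fun z _ => ?_
          rw [pow_two, Finset.sum_mul_sum, Finset.sum_product]
          refine Finset.sum_congr rfl fun i _ => Finset.sum_congr rfl fun j _ => ?_
          rw [Finset.sum_mul_sum, Finset.sum_product]
  rw [hswap]
  have hB : ∀ z, (∑ i ∈ I, ∑ k ∈ I, lam z ^ (i.dist k)) ^ 2 ≤
      4 * (t : ℝ) ^ 2 * (∑ a ∈ Finset.range t, lam z ^ a) ^ 2 := by
    intro z
    have h1 := sum_pow_dist_le (tUnif G) t (h.nonneg z)
    have h2 := pow_le_pow_left₀ (Finset.sum_nonneg fun i _ => Finset.sum_nonneg fun k _ =>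
      pow_nonneg (h.nonneg z) _) h1 2
    exact h2.trans (le_of_eq (by ring))
  have hsum : ∑ z, (∑ a ∈ Finset.range t, lam z ^ a) ^ 2 ≤
      (t : ℝ) ^ 2 + 88 * (Fintype.card V * (tRel G : ℝ) ^ (5 / 3 : ℝ)) := by
    -- The eigenvalue `1` yields exactly `t²`; every other geometric sum is at most an inverse gap.
    rw [← Finset.add_sum_erase _ _ (Finset.mem_univ q₀), h.top]
    refine add_le_add (by simp) (le_trans (Finset.sum_le_sum fun z hz => ?_)
      (h.sum_inv_gap_sq_le hG))
    exact pow_le_pow_left₀ (Finset.sum_nonneg fun a _ => pow_nonneg (h.nonneg z) _)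
      (sum_range_pow_le_inv (h.nonneg z) (h.lt_one (Finset.ne_of_mem_erase hz)) t) 2
  have hA : 0 ≤ (Fintype.card V : ℝ) * (tRel G : ℝ) ^ (5 / 3 : ℝ) := by positivity
  set A := (Fintype.card V : ℝ) * (tRel G : ℝ) ^ (5 / 3 : ℝ)
  calc c * ∑ z, (∑ i ∈ I, ∑ k ∈ I, lam z ^ (i.dist k)) ^ 2
      ≤ c * ∑ z, 4 * (t : ℝ) ^ 2 * (∑ a ∈ Finset.range t, lam z ^ a) ^ 2 :=
        mul_le_mul_of_nonneg_left (Finset.sum_le_sum fun z _ => hB z) hc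
    _ = c * (4 * (t : ℝ) ^ 2 * ∑ z, (∑ a ∈ Finset.range t, lam z ^ a) ^ 2) := by
        rw [← Finset.mul_sum]
    _ ≤ c * (4 * (t : ℝ) ^ 2 * ((t : ℝ) ^ 2 + 88 * A)) := by gcongr
    _ ≤ c * (4 * (t : ℝ) ^ 2 * (88 * ((t : ℝ) ^ 2 + A))) := by
        have : 0 ≤ (t : ℝ) ^ 2 := by positivity
        gcongr
        linarith
    _ = (275 / 2) * ((t : ℝ) ^ 2 / (numEdges G : ℝ) ^ 2 * ((t : ℝ) ^ 2 + A)) := by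
        simp only [c]
        field_simp
        ring
    _ ≤ _ := by
        have : 0 ≤ (t : ℝ) ^ 2 / (numEdges G : ℝ) ^ 2 * ((t : ℝ) ^ 2 + A) := by positivity
        linarith

end Moments

/-! ### The estimator depends only on ranks and degrees. -/

section Profile

set_option linter.unusedSectionVars false

variable {V : Type*} [Fintype V] [DecidableEq V]

lemma exists_first_occurrence {N : ℕ} (u : Fin N → V) (i : Fin N) :
    ∃ a, u a = u i ∧ ∀ l, u l = u i → a ≤ l := by
  obtain ⟨a, ha, hmin⟩ := (Finset.univ.filter fun l => u l = u i).exists_minimal ⟨i, by simp⟩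
  refine ⟨a, (Finset.mem_filter.1 ha).2, fun l hl => ?_⟩
  rcases le_total a l with h | h
  · exact h
  · exact hmin (by simpa using hl) h

/-- Everything counted in the rank of `u i` has occurred before `b`, the first occurrence of `u j`;
the vertex at `b` itself is new. -/
lemma rank_lt_rank {N : ℕ} {u : Fin N → V} {i j a b : Fin N} (ha : u a = u i)
    (hb : u b = u j) (hbmin : ∀ l, u l = u j → b ≤ l) (hab : a < b) : rank u i < rank u j := by
  refine Set.ncard_lt_ncard ⟨?_, ?_⟩ (Set.toFinite _)
  · rintro v ⟨l, hl, hmin⟩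
    exact ⟨l, hl, fun l' hl' => ((hmin a ha).trans hab.le).trans (hbmin l' hl')⟩
  · intro hsub
    obtain ⟨l, hl, hmin⟩ := hsub ⟨b, hb, hbmin⟩
    exact absurd (hmin a ha) (not_le.2 (hab.trans_le (hbmin l hl)))

/-- Ranks of occurrence identify the vertices of a sequence. -/
lemma rank_eq_rank_iff {N : ℕ} (u : Fin N → V) (i j : Fin N) :
    rank u i = rank u j ↔ u i = u j := by
  constructor
  · intro h
    obtain ⟨a, ha, hamin⟩ := exists_first_occurrence u i
    obtain ⟨b, hb, hbmin⟩ := exists_first_occurrence u j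
    rcases lt_trichotomy a b with hab | hab | hab
    · exact absurd h (rank_lt_rank ha hb hbmin hab).ne
    · rw [← ha, hab, hb]
    · exact absurd h (rank_lt_rank hb ha hamin hab).ne'
  · intro h
    simp only [rank, h]

lemma concatPaths_apply {M L : ℕ} (w : Fin M → ℕ → V) (a : Fin M) {i : ℕ} (hi : i < L) :
    concatPaths L w (finProdFinEquiv (a, ⟨i, hi⟩)) = w a i := by
  simp [concatPaths]

/-- Position `i` of the `a`-th of `M` concatenated sequences of length `L`. -/
def blockEntry {M L : ℕ} (r : Fin (M * L) → ℕ) (a : Fin M) (i : ℕ) : ℕ :=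
  if h : i < L then r (finProdFinEquiv (a, ⟨i, h⟩)) else 0

/-- The edge estimator computed from a profile. -/
def profileEstimator (s t K : ℕ)
    (r : (Fin (K * 2 * (s + t)) → ℕ) × (Fin (K * 2 * (s + t)) → ℕ)) : ℝ :=
  (t : ℝ) ^ 2 / (2 / (K : ℝ) * ∑ k : Fin K,
    ∑ i ∈ Finset.Ico s (s + t), ∑ j ∈ Finset.Ico s (s + t),
      if blockEntry r.1 (finProdFinEquiv (k, 0)) i = blockEntry r.1 (finProdFinEquiv (k, 1)) j
      then 1 / (blockEntry r.2 (finProdFinEquiv (k, 0)) i : ℝ) else 0)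

theorem edgeEstimator_eq_profileEstimator (G : SimpleGraph V) [DecidableRel G.Adj] (s t K : ℕ)
    (w : Fin (K * 2) → ℕ → V) :
    edgeEstimator G s t K w = profileEstimator s t K (profile G (concatPaths (s + t) w)) := by
  unfold edgeEstimator profileEstimator weightedIntersections
  congr 2
  refine Finset.sum_congr rfl fun k _ => Finset.sum_congr rfl fun i hi =>
    Finset.sum_congr rfl fun j hj => ?_
  have hi' := (Finset.mem_Ico.1 hi).2
  have hj' := (Finset.mem_Ico.1 hj).2
  have hdeg : G.degree (concatPaths (s + t) w (finProdFinEquiv (finProdFinEquiv (k, 0), ⟨i, hi'⟩))) =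
      G.degree (w (finProdFinEquiv (k, 0)) i) := by
    have h : ∀ a b : V, a = b → G.degree a = G.degree b := by
      rintro a b rfl
      rfl
    exact h _ _ (concatPaths_apply w _ hi')
  simp only [blockEntry, dif_pos hi', dif_pos hj', profile, hdeg, rank_eq_rank_iff, concatPaths_apply w _ hi',
    concatPaths_apply w _ hj']

end Profile

/-! ### Chebyshev's inequality for the sum over pairs of walks. -/

section Concentration

set_option linter.unusedSectionVars false

variable {V : Type*} [Fintype V] [DecidableEq V] {G : SimpleGraph V} [DecidableRel G.Adj]
  [MeasurableSpace V] [MeasurableSingletonClass V] {x : V} {Ω : Type*} [MeasurableSpace Ω]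
  {μ : Measure Ω} [IsProbabilityMeasure μ]

lemma measurable_weightedIntersections (s t : ℕ) :
    Measurable fun p : (ℕ → V) × (ℕ → V) => weightedIntersections G s t p.1 p.2 := by
  simp_rw [weightedIntersections_eq]
  refine Finset.measurable_sum _ fun p _ => Finset.measurable_sum _ fun u _ => ?_
  exact (((measurable_visits _ _ _ _).comp measurable_fst).mul
    ((measurable_visits _ _ _ _).comp measurable_snd)).mul_const _

lemma abs_weightedIntersections_le (s t : ℕ) (a b : ℕ → V) :
    |weightedIntersections G s t a b| ≤
      ∑ _p ∈ Finset.Ico s (s + t) ×ˢ Finset.Ico s (s + t), ∑ u, 1 / (G.degree u : ℝ) := by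
  rw [weightedIntersections_eq]
  refine (Finset.abs_sum_le_sum_abs _ _).trans (Finset.sum_le_sum fun p _ =>
    (Finset.abs_sum_le_sum_abs _ _).trans (Finset.sum_le_sum fun u _ => ?_))
  have h : 0 ≤ 1 / (G.degree u : ℝ) := by positivity
  rw [abs_mul, abs_mul, abs_of_nonneg h]
  exact mul_le_of_le_one_left h
    (mul_le_one₀ (abs_visits_le _ _ _ _ _) (abs_nonneg _) (abs_visits_le _ _ _ _ _))

/-- If the sum of the intersection counts is close to its typical value `D`, the estimator is
accurate. -/
lemma abs_div_sub_one_le {D E S : ℝ} (hD : 0 < D) (hE : |E - D| ≤ 1 / 16 * D)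
    (hS : |S - E| < D / 4) : |D / S - 1| ≤ 1 / 2 := by
  rw [abs_le] at hE ⊢
  rw [abs_lt] at hS
  have hS0 : 0 < S := by linarith
  constructor
  · have : 1 / 2 ≤ D / S := by
      rw [le_div_iff₀ hS0]
      linarith
    linarith
  · have : D / S ≤ 3 / 2 := by
      rw [div_le_iff₀ hS0]
      linarith
    linarith

/-- The hypothesis on `t` says `n t_rel^{5/3} ≤ t²/c²`, so the second moment of one count is of the
order of its squared mean `(t²/2m)²`. Averaging `K` independent counts gains the factor `1/K`. -/
theorem edgeEstimator_error_le [Nontrivial V] (hG : G.Connected) {c : ℝ} (hc : 0 < c) {t K : ℕ}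
    (hK : 1 ≤ K)
    (ht : c * ((tRel G : ℝ) ^ (5 / 6 : ℝ) * √(Fintype.card V : ℝ)) ≤ (t : ℝ))
    {W : Fin (K * 2) → ℕ → Ω → V} (hW : ∀ a, IsLazyWalk G x μ (W a))
    (hind : iIndepFun (fun a ω i => W a i ω) μ) :
    μ.real {ω | 1 / 2 < |edgeEstimator G (tUnif G) t K (fun a i => W a i ω) /
      (numEdges G : ℝ) - 1|} ≤ 8832 * (1 + 1 / c ^ 2) / (K : ℝ) := by
  have hm := numEdges_pos hG
  have hT := one_le_tRel hG
  have hn : (0 : ℝ) < Fintype.card V := by exact_mod_cast Fintype.card_pos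
  have hK0 : (0 : ℝ) < K := by exact_mod_cast hK
  have ht0 : (0 : ℝ) < t := by
    have : 0 < (tRel G : ℝ) ^ (5 / 6 : ℝ) := Real.rpow_pos_of_pos (by linarith) _
    have := Real.sqrt_pos.2 hn
    exact lt_of_lt_of_le (by positivity) ht
  set A : ℝ := (Fintype.card V : ℝ) * (tRel G : ℝ) ^ (5 / 3 : ℝ)
  have hA : c ^ 2 * A ≤ (t : ℝ) ^ 2 := by
    have h1 := pow_le_pow_left₀ (by positivity) ht 2
    rw [mul_pow, mul_pow, Real.sq_sqrt hn.le, ← Real.rpow_natCast ((tRel G : ℝ) ^ (5 / 6 : ℝ)),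
      ← Real.rpow_mul (by linarith)] at h1
    have h2 : (5 / 6 : ℝ) * (2 : ℕ) = 5 / 3 := by norm_num
    rw [h2, mul_comm ((tRel G : ℝ) ^ (5 / 3 : ℝ))] at h1
    exact h1
  let J : Fin K → Ω → ℝ := fun k ω => interJ G t (fun i => W (finProdFinEquiv (k, 0)) i ω)
    (fun i => W (finProdFinEquiv (k, 1)) i ω)
  have hpair : ∀ k : Fin K, IndepFun (fun ω i => W (finProdFinEquiv (k, 0)) i ω)
      (fun ω i => W (finProdFinEquiv (k, 1)) i ω) μ := fun k =>
    hind.indepFun (by simp)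
  have hJm : ∀ k, Measurable (J k) := fun k =>
    (measurable_weightedIntersections (G := G) (tUnif G) t).comp
      ((hW _).measurable_process.prodMk (hW _).measurable_process)
  have hJL : ∀ k, MemLp (J k) 2 μ := fun k =>
    MemLp.of_bound (hJm k).aestronglyMeasurable _
      (Filter.Eventually.of_forall fun ω => abs_weightedIntersections_le _ _ _ _)
  have hJind : ((Finset.univ : Finset (Fin K)) : Set (Fin K)).Pairwise
      fun k l => IndepFun (J k) (J l) μ := by
    intro k _ l _ hkl
    have h := hind.indepFun_prodMk_prodMk (fun a => (hW a).measurable_process)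
      (finProdFinEquiv (k, 0)) (finProdFinEquiv (k, 1)) (finProdFinEquiv (l, 0))
      (finProdFinEquiv (l, 1)) (by simp [hkl]) (by simp [hkl]) (by simp [hkl]) (by simp [hkl])
    exact h.comp (measurable_weightedIntersections (G := G) (tUnif G) t)
      (measurable_weightedIntersections (G := G) (tUnif G) t)
  let S : Ω → ℝ := ∑ k, J k
  have hSL : MemLp S 2 μ := memLp_finsetSum' _ fun k _ => hJL k
  set D : ℝ := K * ((t : ℝ) ^ 2 / (2 * numEdges G))
  have hD : 0 < D := by positivity
  have hES : |μ[S] - D| ≤ 1 / 16 * D := by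
    have h1 : μ[S] = ∑ k, ∫ ω, J k ω ∂μ := by
      rw [← integral_finsetSum _ fun k _ => (hJL k).integrable (by norm_num)]
      simp [S]
    have h2 : D = ∑ _k : Fin K, (t : ℝ) ^ 2 / (2 * numEdges G) := by simp [D]
    rw [h1, h2, ← Finset.sum_sub_distrib, Finset.mul_sum]
    exact (Finset.abs_sum_le_sum_abs _ _).trans (Finset.sum_le_sum fun k _ =>
      abs_integral_interJ_sub_le hG (hW _) (hW _) (hpair k) t)
  have hVar : variance S μ ≤
      K * (138 * ((t : ℝ) ^ 2 / (numEdges G : ℝ) ^ 2 * ((t : ℝ) ^ 2 + A))) := by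
    rw [IndepFun.variance_sum (fun k _ => hJL k) hJind]
    calc ∑ k, variance (J k) μ
        ≤ ∑ _k : Fin K, 138 * ((t : ℝ) ^ 2 / (numEdges G : ℝ) ^ 2 * ((t : ℝ) ^ 2 + A)) :=
          Finset.sum_le_sum fun k _ =>
            (variance_le_expectation_sq (hJm k).aestronglyMeasurable).trans
              (integral_interJ_sq_le hG (hW _) (hW _) (hpair k) t)
      _ = _ := by simp
  have hsub : {ω | 1 / 2 < |edgeEstimator G (tUnif G) t K (fun a i => W a i ω) /
      (numEdges G : ℝ) - 1|} ⊆ {ω | D / 4 ≤ |S ω - μ[S]|} := by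
    intro ω hω
    by_contra hcon
    rw [Set.mem_ofPred_eq] at hω hcon
    refine absurd hω (not_lt.2 ?_)
    have h1 : edgeEstimator G (tUnif G) t K (fun a i => W a i ω) / (numEdges G : ℝ) = D / S ω := by
      have h2 : S ω = ∑ k, weightedIntersections G (tUnif G) t
          (fun i => W (finProdFinEquiv (k, 0)) i ω) (fun i => W (finProdFinEquiv (k, 1)) i ω) := by
        simp [S, J, interJ]
      rw [edgeEstimator, ← h2]
      simp only [D]
      -- If no pair meets, both sides are `0` by the convention for division by zero.
      rcases eq_or_ne (S ω) 0 with h0 | h0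
      · simp [h0]
      · field_simp
    rw [h1]
    exact abs_div_sub_one_le hD hES (not_le.1 hcon)
  have hcheb := meas_ge_le_variance_div_sq hSL (c := D / 4) (by positivity)
  have hreal : μ.real {ω | D / 4 ≤ |S ω - μ[S]|} ≤ variance S μ / (D / 4) ^ 2 :=
    ENNReal.toReal_le_of_le_ofReal (div_nonneg (variance_nonneg _ _) (by positivity)) hcheb
  have hA' : A ≤ (t : ℝ) ^ 2 * (1 / c ^ 2) := by
    rw [mul_one_div, le_div_iff₀ (by positivity)]
    linarith
  calc _ ≤ μ.real {ω | D / 4 ≤ |S ω - μ[S]|} := measureReal_mono hsub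
    _ ≤ variance S μ / (D / 4) ^ 2 := hreal
    _ ≤ K * (138 * ((t : ℝ) ^ 2 / (numEdges G : ℝ) ^ 2 *
          ((t : ℝ) ^ 2 + (t : ℝ) ^ 2 * (1 / c ^ 2)))) / (D / 4) ^ 2 := by
        refine div_le_div_of_nonneg_right (hVar.trans ?_) (by positivity)
        gcongr
    -- The constant is `8832 = 138 · 64`, since `(D/4)² = K² t⁴ / 64m²`.
    _ = _ := by
        simp only [D]
        field_simp
        ring

end Concentration

end LazyWalk

end

/-! ### Assembly of the five statements and choice of parameters. -/

theorem proposition2 :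
    -- first moment
    (∀ (V : Type u) [Fintype V] [DecidableEq V] [Nontrivial V]
        [MeasurableSpace V] [MeasurableSingletonClass V]
        (G : SimpleGraph V) [DecidableRel G.Adj], G.Connected →
      ∀ (x : V) (t : ℕ)
        (Ω : Type v) [MeasurableSpace Ω] (μ : Measure Ω) [IsProbabilityMeasure μ]
        (X Y : ℕ → Ω → V),
        LazyWalk.IsLazyWalk G x μ X → LazyWalk.IsLazyWalk G x μ Y →
        IndepFun (fun ω i => X i ω) (fun ω i => Y i ω) μ →
        (3 / 4 : ℝ) ^ 2 * ((t : ℝ) ^ 2 / (2 * (LazyWalk.numEdges G : ℝ)))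
            ≤ ∫ ω, LazyWalk.interJ G t (fun i => X i ω) (fun i => Y i ω) ∂μ ∧
          ∫ ω, LazyWalk.interJ G t (fun i => X i ω) (fun i => Y i ω) ∂μ
            ≤ (5 / 4 : ℝ) ^ 2 * ((t : ℝ) ^ 2 / (2 * (LazyWalk.numEdges G : ℝ)))) ∧
    -- second moment
    (∃ C : ℝ, 0 < C ∧
      ∀ (V : Type u) [Fintype V] [DecidableEq V] [Nontrivial V]
        [MeasurableSpace V] [MeasurableSingletonClass V]
        (G : SimpleGraph V) [DecidableRel G.Adj], G.Connected →
      ∀ (x : V) (t : ℕ)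
        (Ω : Type v) [MeasurableSpace Ω] (μ : Measure Ω) [IsProbabilityMeasure μ]
        (X Y : ℕ → Ω → V),
        LazyWalk.IsLazyWalk G x μ X → LazyWalk.IsLazyWalk G x μ Y →
        IndepFun (fun ω i => X i ω) (fun ω i => Y i ω) μ →
        ∫ ω, (LazyWalk.interJ G t (fun i => X i ω) (fun i => Y i ω)) ^ 2 ∂μ
          ≤ C * ((t : ℝ) ^ 2 / (LazyWalk.numEdges G : ℝ) ^ 2 *
              ((t : ℝ) ^ 2 + (Fintype.card V : ℝ) * (LazyWalk.tRel G : ℝ) ^ (5 / 3 : ℝ)))) ∧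
    -- the edge estimator is a function of the profile of the observed trajectories
    (∀ s t K : ℕ,
      ∃ est : (Fin (K * 2 * (s + t)) → ℕ) × (Fin (K * 2 * (s + t)) → ℕ) → ℝ,
      ∀ (V : Type u) [Fintype V] [DecidableEq V] (G : SimpleGraph V) [DecidableRel G.Adj]
        (w : Fin (K * 2) → ℕ → V),
        LazyWalk.edgeEstimator G s t K w
          = est (LazyWalk.profile G (LazyWalk.concatPaths (s + t) w))) ∧
    -- its error probability is `O(1/K)` as soon as `t ≳ t_rel^{5/6} √n`
    (∀ c : ℝ, 0 < c → ∃ C : ℝ, 0 < C ∧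
      ∀ (V : Type u) [Fintype V] [DecidableEq V] [Nontrivial V]
        [MeasurableSpace V] [MeasurableSingletonClass V]
        (G : SimpleGraph V) [DecidableRel G.Adj], G.Connected →
      ∀ (x : V) (t K : ℕ), 1 ≤ K →
        c * ((LazyWalk.tRel G : ℝ) ^ (5 / 6 : ℝ) * √(Fintype.card V : ℝ)) ≤ (t : ℝ) →
      ∀ (Ω : Type v) [MeasurableSpace Ω] (μ : Measure Ω) [IsProbabilityMeasure μ]
        (W : Fin (K * 2) → ℕ → Ω → V),
        (∀ a, LazyWalk.IsLazyWalk G x μ (W a)) →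
        iIndepFun (fun a ω i => W a i ω) μ →
        μ.real {ω | 1 / 2 <
            |LazyWalk.edgeEstimator G (LazyWalk.tUnif G) t K (fun a i => W a i ω) /
              (LazyWalk.numEdges G : ℝ) - 1|} ≤ C / (K : ℝ)) ∧
    -- total cost for error probability `ε`
    (∃ C : ℝ, 0 < C ∧ ∀ ε : ℝ, 0 < ε → ε ≤ 1 → ∃ K₀ : ℕ, 1 ≤ K₀ ∧
      ∀ (V : Type u) [Fintype V] [DecidableEq V] [Nontrivial V]
        [MeasurableSpace V] [MeasurableSingletonClass V]
        (G : SimpleGraph V) [DecidableRel G.Adj], G.Connected →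
      ∃ t₀ : ℕ, 1 ≤ t₀ ∧
        ((K₀ * 2 * (LazyWalk.tUnif G + t₀) : ℕ) : ℝ)
          ≤ C * ε⁻¹ * ((LazyWalk.tUnif G : ℝ) +
              (LazyWalk.tRel G : ℝ) ^ (5 / 6 : ℝ) * √(Fintype.card V : ℝ)) ∧
        ∀ (x : V) (t K : ℕ), t₀ ≤ t → K₀ ≤ K →
        ∀ (Ω : Type v) [MeasurableSpace Ω] (μ : Measure Ω) [IsProbabilityMeasure μ]
          (W : Fin (K * 2) → ℕ → Ω → V),
          (∀ a, LazyWalk.IsLazyWalk G x μ (W a)) →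
          iIndepFun (fun a ω i => W a i ω) μ →
          μ.real {ω | 1 / 2 <
              |LazyWalk.edgeEstimator G (LazyWalk.tUnif G) t K (fun a i => W a i ω) /
                (LazyWalk.numEdges G : ℝ) - 1|} ≤ ε) := by
  refine ⟨?_, ⟨138, by norm_num, ?_⟩, ?_, ?_, ?_⟩
  · intro V _ _ _ _ _ G _ hG x t Ω _ μ _ X Y hX hY hXY
    have h := abs_le.1 (LazyWalk.abs_integral_interJ_sub_le hG hX hY hXY t)
    have h0 : 0 ≤ (t : ℝ) ^ 2 / (2 * (LazyWalk.numEdges G : ℝ)) := by positivity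
    constructor <;> linarith
  · intro V _ _ _ _ _ G _ hG x t Ω _ μ _ X Y hX hY hXY
    exact LazyWalk.integral_interJ_sq_le hG hX hY hXY t
  · exact fun s t K => ⟨LazyWalk.profileEstimator s t K, fun V _ _ G _ w =>
      LazyWalk.edgeEstimator_eq_profileEstimator G s t K w⟩
  · intro c hc
    refine ⟨8832 * (1 + 1 / c ^ 2), by positivity, ?_⟩
    intro V _ _ _ _ _ G _ hG x t K hK ht Ω _ μ _ W hW hind
    exact LazyWalk.edgeEstimator_error_le hG hc hK ht hW hind
  -- With `c = 1` the error is at most `2 · 8832 / K = 17664 / K`, which fixes `K₀` independently of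
  -- the graph. The cost constant is `70660 = 17665 · 2 · 2`, from rounding `K₀` up, two walks per
  -- pair, and `⌈Z⌉ ≤ 2Z`.
  · refine ⟨70660, by norm_num, fun ε hε hε1 => ⟨⌈17664 / ε⌉₊, Nat.ceil_pos.2 (by positivity), ?_⟩⟩
    intro V _ _ _ _ _ G _ hG
    have hT := LazyWalk.one_le_tRel hG
    have hn : (1 : ℝ) ≤ Fintype.card V := by exact_mod_cast Fintype.card_pos
    set Z : ℝ := (LazyWalk.tRel G : ℝ) ^ (5 / 6 : ℝ) * √(Fintype.card V : ℝ)
    have hZ : 1 ≤ Z := one_le_mul_of_one_le_of_one_le (Real.one_le_rpow hT (by norm_num))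
      (Real.one_le_sqrt.2 hn)
    refine ⟨⌈Z⌉₊, Nat.ceil_pos.2 (by linarith), ?_, ?_⟩
    · have h1 : (⌈17664 / ε⌉₊ : ℝ) ≤ 17665 * ε⁻¹ := by
        have h2 := (Nat.ceil_lt_add_one (a := 17664 / ε) (by positivity)).le
        have h3 : 1 ≤ ε⁻¹ := (one_le_inv₀ hε).2 hε1
        rw [div_eq_mul_inv] at h2 ⊢
        linarith
      have h4 : (⌈Z⌉₊ : ℝ) ≤ 2 * Z := by
        have := (Nat.ceil_lt_add_one (a := Z) (by linarith)).le
        linarith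
      have h5 : (0 : ℝ) ≤ LazyWalk.tUnif G := Nat.cast_nonneg _
      push_cast
      calc (⌈17664 / ε⌉₊ : ℝ) * 2 * (LazyWalk.tUnif G + ⌈Z⌉₊)
          ≤ 17665 * ε⁻¹ * 2 * (2 * (LazyWalk.tUnif G + Z)) := by
            gcongr
            linarith
        _ = 70660 * ε⁻¹ * (LazyWalk.tUnif G + Z) := by ring
    · intro x t K ht hK Ω _ μ _ W hW hind
      have hK' : 17664 / ε ≤ (K : ℝ) := (Nat.le_ceil _).trans (by exact_mod_cast hK)
      have hK0 : (0 : ℝ) < K := lt_of_lt_of_le (by positivity) hK'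
      have ht' : 1 * Z ≤ (t : ℝ) := by
        rw [one_mul]
        exact (Nat.le_ceil _).trans (by exact_mod_cast ht)
      refine (LazyWalk.edgeEstimator_error_le hG one_pos (by exact_mod_cast hK0) ht' hW hind).trans ?_
      rw [div_le_iff₀ hε] at hK'
      rw [div_le_iff₀ hK0]
      linarith
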